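/- \textbf{Conventions.} Let $\mathbb H^3$ be hyperbolic 3-space and let $\mathbb L(\mathbb H^3)$ be the space of its oriented geodesics. Assigning to an oriented geodesic its beginning point and its end point on the ideal boundary sphere $S^2$ of the Poincar\'e ball identifies $\mathbb L(\mathbb H^3)$ with $S^2\times S^2$ minus the diagonal, with its standard differentiable structure. In terms of the ideal boundary $\mathbb C\cup\{\infty\}$ of the upper half-space model, let $(\mu_1,\mu_2)$, $1+\mu_1\bar\mu_2\neq 0$, be the holomorphic coordinates of the geodesic that begins at $-\mu_1$ and ends at $1/\bar\mu_2$. The canonical neutral K\"ahler metric $\mathbb G$ on $\mathbb L(\mathbb H^3)$ is the smooth metric (symmetric, of signature $++--$) given in these coordinates by \[ \mathbb G=-i\left[\frac{d\mu_1\, d\bar\mu_2}{(1+\mu_1\bar\mu_2)^2}-\frac{d\bar\mu_1\, d\mu_2}{(1+\bar\mu_1\mu_2)^2}\right], \] where the products of 1-forms are symmetrized products. It is invariant under the orientation-preserving isometries of $\mathbb H^3$. \textbf{Theorem.} Let $S$ be a surface immersed in $\mathbb H^3$ by a $C^4$ immersion and oriented by a continuous unit normal field $N$. Let $\Sigma\subset\mathbb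 L(\mathbb H^3)$ be the (Lagrangian) surface formed by the oriented geodesics normal to $S$, parametrized by the map that sends a point of $S$ to the oriented geodesic through it in the direction $N$. Let $\mathbb G_\Sigma$ be the metric induced on $\Sigma$, that is, the pull-back of $\mathbb G$ by this map, and assume that $\mathbb G_\Sigma$ is non-degenerate at every point. Let $\lambda_1\ge\lambda_2$ be the principal curvatures of $S$, that is, the eigenvalues of the second fundamental form $\langle\nabla_X N,Y\rangle$ relative to the induced Riemannian metric on $S$. Then $S$ is Weingarten, meaning that $\lambda_1,\lambda_2$ are differentiable and \[ d\lambda_1\wedge d\lambda_2=0 \] everywhere on $S$, if and only if the Gauss curvature of the pseudo-Riemannian metric $\mathbb G_\Sigma$ is identically zero. -/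

import Mathlib

open scoped Manifold ContDiff Matrix

noncomputable section

namespace HypSurface

/-! ### Hyperbolic 3-space and its oriented geodesics -/

/-- Minkowski space `ℝ^{3,1}`; the coordinate with index `0` is the time coordinate. -/
abbrev Mink : Type := Fin 4 → ℝ

/-- Euclidean coordinate space of the ball model and of its boundary sphere. -/
abbrev R3 : Type := Fin 3 → ℝ

/-- The Lorentzian inner product of signature `(-,+,+,+)`. -/
def lor (x y : Mink) : ℝ := -(x 0 * y 0) + x 1 * y 1 + x 2 * y 2 + x 3 * y 3

/-- Hyperbolic 3-space (hyperboloid model). Its Riemannian metric is the restriction of `lor`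
to the tangent spaces `{v | lor x v = 0}`. -/
def hyp3 : Set Mink := {x | lor x x = -1 ∧ 0 < x 0}

/-- The isometry from the hyperboloid model to the Poincare ball model. -/
def toBall (x : Mink) : R3 := ![x 1 / (1 + x 0), x 2 / (1 + x 0), x 3 / (1 + x 0)]

/-- The unit speed geodesic of `hyp3` with initial point `x` and initial unit vector `n`. -/
def geod (x n : Mink) (r : ℝ) : Mink := Real.cosh r • x + Real.sinh r • n

/-- The point of the unit sphere (the ideal boundary of the ball model) determined by a
null vector `p`. -/
def ideal (p : Mink) : R3 := ![p 1 / p 0, p 2 / p 0, p 3 / p 0]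

/-- The space `L(H³) = S² × S² - Δ` of oriented geodesics of hyperbolic 3-space: a geodesic is
identified with the pair (beginning point, end point) on the boundary sphere of the ball model. -/
def geodSpace : Set (R3 × R3) := {γ | γ.1 ⬝ᵥ γ.1 = 1 ∧ γ.2 ⬝ᵥ γ.2 = 1 ∧ γ.1 ≠ γ.2}

/-- The beginning point of the oriented geodesic through `x` with unit direction `n`. -/
def geodBegin (x n : Mink) : R3 := ideal (x - n)

/-- The end point of the oriented geodesic through `x` with unit direction `n`. -/
def geodEnd (x n : Mink) : R3 := ideal (x + n)

/-- The canonical neutral Kaehler metric on `L(H³) = S² × S² - Δ`, at the geodesic `(b, e)`,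
evaluated on two tangent vectors. It is the symmetric bilinear form with quadratic form
`det (e - b, X, Y) / (1 - ⟨b, e⟩)²` at `(X, Y)`. The fact `neutralMetric_holomorphic` below shows
that in the holomorphic coordinates `(μ₁, μ₂)` it is
`-i (dμ₁ dμ̄₂ / (1 + μ₁ μ̄₂)² - dμ̄₁ dμ₂ / (1 + μ̄₁ μ₂)²)`. -/
def neutralMetric (γ V W : R3 × R3) : ℝ :=
  ((γ.2 - γ.1) ⬝ᵥ (V.1 ⨯₃ W.2) + (γ.2 - γ.1) ⬝ᵥ (W.1 ⨯₃ V.2)) / (2 * (1 - γ.1 ⬝ᵥ γ.2) ^ 2)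

/-- Inverse stereographic projection of `ℂ` onto the unit sphere. -/
def invStereo (μ : ℂ) : R3 :=
  ![2 * μ.re / (1 + (μ.re ^ 2 + μ.im ^ 2)), 2 * μ.im / (1 + (μ.re ^ 2 + μ.im ^ 2)),
    (1 - (μ.re ^ 2 + μ.im ^ 2)) / (1 + (μ.re ^ 2 + μ.im ^ 2))]

/-- The oriented geodesic with holomorphic coordinates `(μ₁, μ₂)`, where `1 + μ₁ μ̄₂ ≠ 0`. On the
boundary of the upper half-space model it begins at `-μ₁` and ends at `1 / μ̄₂`. -/
def ofHolomorphic (μ₁ μ₂ : ℂ) : R3 × R3 := (-invStereo μ₁, invStereo μ₂)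

/-! ### Curvature of a metric on a surface -/

/-- The model plane of a surface. -/
abbrev E2 : Type := EuclideanSpace ℝ (Fin 2)

/-- The coordinate vector `∂_i`. -/
def cvec (i : Fin 2) : E2 := EuclideanSpace.single i 1

/-- Partial derivative in the direction of the `i`-th coordinate. -/
def pd (i : Fin 2) (F : E2 → ℝ) (u : E2) : ℝ := fderiv ℝ F u (cvec i)

/-- Christoffel symbols `Γ^k_{ij}` of a (pseudo-Riemannian) metric `(g_{ij})` in the plane. -/
def christoffel (g : E2 → Matrix (Fin 2) (Fin 2) ℝ) (k i j : Fin 2) (u : E2) : ℝ :=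
  (1 / 2) * ∑ l, (g u)⁻¹ k l *
    (pd i (fun x => g x j l) u + pd j (fun x => g x i l) u - pd l (fun x => g x i j) u)

/-- Components of the Riemann tensor: `R(∂_i, ∂_j) ∂_k = R^l_{kij} ∂_l`. -/
def riemann (g : E2 → Matrix (Fin 2) (Fin 2) ℝ) (l k i j : Fin 2) (u : E2) : ℝ :=
  pd i (christoffel g l j k) u - pd j (christoffel g l i k) u
    + ∑ m, (christoffel g l i m u * christoffel g m j k u
        - christoffel g l j m u * christoffel g m i k u)

/-- Gauss curvature of a metric in the plane:
`K = ⟨R(∂_0, ∂_1) ∂_1, ∂_0⟩ / (g_{00} g_{11} - g_{01}²)`. -/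
def planeGaussCurvature (g : E2 → Matrix (Fin 2) (Fin 2) ℝ) (u : E2) : ℝ :=
  (∑ l, g u 0 l * riemann g l 1 0 1 u) / (g u).det

section Surface

variable {M : Type*} [TopologicalSpace M] [ChartedSpace E2 M]

/-- The matrix of a field `g` of bilinear forms on `M` in the coordinates of the chart at `m`. -/
def metricCoeff (g : (p : M) → TangentSpace 𝓘(ℝ, E2) p → TangentSpace 𝓘(ℝ, E2) p → ℝ) (m : M)
    (u : E2) : Matrix (Fin 2) (Fin 2) ℝ :=
  Matrix.of fun i j => g ((chartAt E2 m).symm u)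
    (mfderiv 𝓘(ℝ, E2) 𝓘(ℝ, E2) (chartAt E2 m).symm u (cvec i))
    (mfderiv 𝓘(ℝ, E2) 𝓘(ℝ, E2) (chartAt E2 m).symm u (cvec j))

/-- The Gauss curvature at `m` of a field `g` of bilinear forms on `M`, computed in the
chart at `m`. -/
def gaussCurvature (g : (p : M) → TangentSpace 𝓘(ℝ, E2) p → TangentSpace 𝓘(ℝ, E2) p → ℝ)
    (m : M) : ℝ :=
  planeGaussCurvature (metricCoeff g m) (chartAt E2 m m)

/-! ### Oriented surfaces in hyperbolic 3-space -/

/-- `φ : M → H³` is a `C⁴` immersion of a surface, oriented by the continuous unit normal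
vector field `N`. -/
structure IsOrientedImmersion (φ N : M → Mink) : Prop where
  mem_hyp3 : ∀ m, φ m ∈ hyp3
  contMDiff : ContMDiff 𝓘(ℝ, E2) 𝓘(ℝ, Mink) 4 φ
  immersion : ∀ m, Function.Injective (mfderiv 𝓘(ℝ, E2) 𝓘(ℝ, Mink) φ m)
  normal_continuous : Continuous N
  normal_tangent_hyp3 : ∀ m, lor (φ m) (N m) = 0
  normal_unit : ∀ m, lor (N m) (N m) = 1
  normal_orthogonal : ∀ (m : M) (v : TangentSpace 𝓘(ℝ, E2) m),
    lor (N m) (mfderiv 𝓘(ℝ, E2) 𝓘(ℝ, Mink) φ m v) = 0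

/-- First fundamental form: the metric induced from hyperbolic space. -/
def firstForm (φ : M → Mink) (m : M) (v w : TangentSpace 𝓘(ℝ, E2) m) : ℝ :=
  lor (mfderiv 𝓘(ℝ, E2) 𝓘(ℝ, Mink) φ m v) (mfderiv 𝓘(ℝ, E2) 𝓘(ℝ, Mink) φ m w)

/-- Second fundamental form `⟨∇_v N, w⟩`. The Levi-Civita connection of the hyperboloid is the
tangential part of the flat derivative, and the part of `dN v` normal to the hyperboloid is
`lor`-orthogonal to `dφ w`. -/
def secondForm (φ N : M → Mink) (m : M) (v w : TangentSpace 𝓘(ℝ, E2) m) : ℝ :=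
  lor (mfderiv 𝓘(ℝ, E2) 𝓘(ℝ, Mink) N m v) (mfderiv 𝓘(ℝ, E2) 𝓘(ℝ, Mink) φ m w)

/-- `c` is an eigenvalue at `m` of the second fundamental form relative to the first. -/
def IsPrincipalCurvature (φ N : M → Mink) (m : M) (c : ℝ) : Prop :=
  ∃ v : TangentSpace 𝓘(ℝ, E2) m, v ≠ 0 ∧ ∀ w, secondForm φ N m v w = c * firstForm φ m v w

/-- The larger principal curvature. -/
def curv₁ (φ N : M → Mink) (m : M) : ℝ := sSup {c | IsPrincipalCurvature φ N m c}

/-- The smaller principal curvature. -/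
def curv₂ (φ N : M → Mink) (m : M) : ℝ := sInf {c | IsPrincipalCurvature φ N m c}

/-- The surface is Weingarten: its principal curvatures `λ₁, λ₂` are differentiable and
`dλ₁ ∧ dλ₂ = 0`. -/
def IsWeingarten (φ N : M → Mink) : Prop :=
  MDifferentiable 𝓘(ℝ, E2) 𝓘(ℝ, ℝ) (curv₁ φ N) ∧ MDifferentiable 𝓘(ℝ, E2) 𝓘(ℝ, ℝ) (curv₂ φ N) ∧
  ∀ (m : M) (v w : TangentSpace 𝓘(ℝ, E2) m),
    (show ℝ from mfderiv 𝓘(ℝ, E2) 𝓘(ℝ, ℝ) (curv₁ φ N) m v) *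
        (show ℝ from mfderiv 𝓘(ℝ, E2) 𝓘(ℝ, ℝ) (curv₂ φ N) m w)
      - (show ℝ from mfderiv 𝓘(ℝ, E2) 𝓘(ℝ, ℝ) (curv₁ φ N) m w) *
        (show ℝ from mfderiv 𝓘(ℝ, E2) 𝓘(ℝ, ℝ) (curv₂ φ N) m v) = 0

/-- The map `M → L(H³)` sending a point of the surface to its oriented normal geodesic. Its image
is the surface `Σ`, parametrized by `M`. -/
def normalMap (φ N : M → Mink) (m : M) : R3 × R3 :=
  (geodBegin (φ m) (N m), geodEnd (φ m) (N m))

/-- The metric induced on the surface of normal geodesics by the neutral Kaehler metric. -/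
def inducedMetric (φ N : M → Mink) (m : M) (v w : TangentSpace 𝓘(ℝ, E2) m) : ℝ :=
  neutralMetric (normalMap φ N m)
    (mfderiv 𝓘(ℝ, E2) 𝓘(ℝ, R3 × R3) (normalMap φ N) m v)
    (mfderiv 𝓘(ℝ, E2) 𝓘(ℝ, R3 × R3) (normalMap φ N) m w)

/-- A field of bilinear forms is non-degenerate at every point. -/
def IsNondegenerate (g : (p : M) → TangentSpace 𝓘(ℝ, E2) p → TangentSpace 𝓘(ℝ, E2) p → ℝ) :
    Prop :=
  ∀ (m : M) (v : TangentSpace 𝓘(ℝ, E2) m), (∀ w, g m v w = 0) → v = 0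

end Surface

theorem hasDerivAt_invStereo (μ : ℝ → ℂ) (a : ℂ) (t : ℝ) (h : HasDerivAt μ a t) :
    HasDerivAt (fun s => invStereo (μ s))
      (let d := 1 + ((μ t).re ^ 2 + (μ t).im ^ 2)
       let d' := 2 * ((μ t).re * a.re + (μ t).im * a.im)
       ![(2 * a.re * d - 2 * (μ t).re * d') / d ^ 2, (2 * a.im * d - 2 * (μ t).im * d') / d ^ 2,
          -2 * d' / d ^ 2]) t := by
  have hre : HasDerivAt (fun s => (μ s).re) a.re t := by
    exact Complex.reCLM.hasFDerivAt.comp_hasDerivAt t h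
  have him : HasDerivAt (fun s => (μ s).im) a.im t := by
    exact Complex.imCLM.hasFDerivAt.comp_hasDerivAt t h
  have hq := (hre.pow 2).add (him.pow 2)
  have hd := hq.const_add 1
  have h0 : 1 + ((μ t).re ^ 2 + (μ t).im ^ 2) ≠ 0 := by positivity
  rw [hasDerivAt_pi]
  intro i
  fin_cases i
  · refine ((hre.const_mul 2).div hd h0).congr_deriv ?_
    simp; ring
  · refine ((him.const_mul 2).div hd h0).congr_deriv ?_
    simp; ring
  · refine ((hq.const_sub 1).div hd h0).congr_deriv ?_
    simp; ring

theorem neutralMetric_holomorphic (μ₁ μ₂ : ℝ → ℂ) (a₁ a₂ : ℂ) (t : ℝ)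
    (h₁ : HasDerivAt μ₁ a₁ t) (h₂ : HasDerivAt μ₂ a₂ t)
    (h : 1 + μ₁ t * starRingEnd ℂ (μ₂ t) ≠ 0) :
    ∃ V : R3 × R3, HasDerivAt (fun s => ofHolomorphic (μ₁ s) (μ₂ s)) V t ∧
      ((neutralMetric (ofHolomorphic (μ₁ t) (μ₂ t)) V V : ℝ) : ℂ) =
        -Complex.I * (a₁ * starRingEnd ℂ a₂ / (1 + μ₁ t * starRingEnd ℂ (μ₂ t)) ^ 2
          - starRingEnd ℂ a₁ * a₂ / (1 + starRingEnd ℂ (μ₁ t) * μ₂ t) ^ 2) := by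
  refine ⟨_, (hasDerivAt_invStereo μ₁ a₁ t h₁).neg.prodMk (hasDerivAt_invStereo μ₂ a₂ t h₂), ?_⟩
  generalize μ₁ t = z at *
  generalize μ₂ t = w at *
  obtain ⟨x, y⟩ := z
  obtain ⟨p, q⟩ := w
  obtain ⟨a, b⟩ := a₁
  obtain ⟨c, d⟩ := a₂
  have hX : (1 + (⟨x, y⟩ : ℂ) * starRingEnd ℂ ⟨p, q⟩) = ⟨1 + x * p + y * q, y * p - x * q⟩ := by
    apply Complex.ext <;> simp <;> ring
  have hY : (1 + starRingEnd ℂ ⟨x, y⟩ * (⟨p, q⟩ : ℂ)) = ⟨1 + x * p + y * q, -(y * p - x * q)⟩ := by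
    apply Complex.ext <;> simp <;> ring
  rw [hX] at h
  rw [hX, hY]
  have hn : (1 + x * p + y * q) ^ 2 + (y * p - x * q) ^ 2 ≠ 0 := by
    intro h0
    apply h
    apply Complex.ext <;> simp <;> nlinarith [sq_nonneg (1 + x * p + y * q), sq_nonneg (y * p - x * q)]
  have h1 : 1 + (x ^ 2 + y ^ 2) ≠ 0 := by positivity
  have h2 : 1 + (p ^ 2 + q ^ 2) ≠ 0 := by positivity
  have key : ∀ u v : ℝ, u ^ 2 + v ^ 2 ≠ 0 → ∀ A : ℂ, ∀ B : ℂ,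
      A / (⟨u, v⟩ : ℂ) ^ 2 - B / (⟨u, -v⟩ : ℂ) ^ 2 =
       (A * (⟨u, -v⟩ : ℂ) ^ 2 - B * (⟨u, v⟩ : ℂ) ^ 2) / (((u ^ 2 + v ^ 2) ^ 2 : ℝ) : ℂ) := by
    intro u v huv A B
    have hm : (⟨u, v⟩ : ℂ) * ⟨u, -v⟩ = ((u ^ 2 + v ^ 2 : ℝ) : ℂ) := by
      apply Complex.ext
      · rw [Complex.ofReal_re]; simp; ring
      · rw [Complex.ofReal_im]; simp; ring
    have hne : (⟨u, v⟩ : ℂ) * ⟨u, -v⟩ ≠ 0 := by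
      rw [hm]; exact_mod_cast huv
    have e1 := left_ne_zero_of_mul hne
    have e2 := right_ne_zero_of_mul hne
    rw [div_sub_div _ _ (pow_ne_zero 2 e1) (pow_ne_zero 2 e2), ← mul_pow, hm]
    push_cast
    ring
  rw [key _ _ hn]
  have hdot : 1 - (ofHolomorphic ⟨x, y⟩ ⟨p, q⟩).1 ⬝ᵥ (ofHolomorphic ⟨x, y⟩ ⟨p, q⟩).2
     = 2 * ((1 + x * p + y * q) ^ 2 + (y * p - x * q) ^ 2) /
       ((1 + (x ^ 2 + y ^ 2)) * (1 + (p ^ 2 + q ^ 2))) := by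
    simp [ofHolomorphic, invStereo, dotProduct, Fin.sum_univ_three]
    field_simp
    ring
  rw [neutralMetric, hdot]
  rw [← mul_div_assoc]
  rw [eq_div_iff (by exact_mod_cast pow_ne_zero 2 hn), ← Complex.ofReal_mul]
  have hdot2 : ∀ r : ℝ, ∀ n D : ℝ, n ≠ 0 → r / (2 * (2 * n / D) ^ 2) * n ^ 2 = r * D ^ 2 / 8 := by
    intro r n D hn
    rcases eq_or_ne D 0 with rfl | hD
    · simp
    · field_simp
      norm_num
  rw [hdot2 _ _ _ hn]
  apply Complex.ext
  · rw [Complex.ofReal_re]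
    simp [ofHolomorphic, invStereo, cross_apply, dotProduct, Fin.sum_univ_three, pow_two]
    field_simp
    ring
  · rw [Complex.ofReal_im]
    simp [pow_two]
    ring

theorem geod_aux {x n : Mink} (hx : x ∈ hyp3) (hxn : lor x n = 0) (hn : lor n n = 1) :
    0 < x 0 - n 0 ∧ 0 < x 0 + n 0 := by
  obtain ⟨h1, h2⟩ := hx
  simp only [lor] at *
  have hlt : |n 0| < x 0 := by
    apply abs_lt_of_sq_lt_sq _ h2.le
    by_contra hc
    push Not at hc
    have cs : (x 0 * n 0) ^ 2 ≤ (x 0 ^ 2 - 1) * (n 0 ^ 2 + 1) := by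
      have a1 : x 0 * n 0 = x 1 * n 1 + x 2 * n 2 + x 3 * n 3 := by linarith
      have a2 : x 0 ^ 2 - 1 = x 1 ^ 2 + x 2 ^ 2 + x 3 ^ 2 := by linarith
      have a3 : n 0 ^ 2 + 1 = n 1 ^ 2 + n 2 ^ 2 + n 3 ^ 2 := by linarith
      rw [a1, a2, a3]
      linarith [sq_nonneg (x 1 * n 2 - x 2 * n 1), sq_nonneg (x 1 * n 3 - x 3 * n 1),
        sq_nonneg (x 2 * n 3 - x 3 * n 2)]
    linarith
  have := abs_lt.1 hlt
  constructor <;> linarith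

/-- The normal geodesic is an element of `L(H³)`. -/
theorem geod_mem {x n : Mink} (hx : x ∈ hyp3) (hxn : lor x n = 0) (hn : lor n n = 1) :
    (geodBegin x n, geodEnd x n) ∈ geodSpace := by
  obtain ⟨h1, h2⟩ := geod_aux hx hxn hn
  have h3 := hx.1
  simp only [lor] at *
  have e1 : geodBegin x n ⬝ᵥ geodBegin x n = 1 := by
    simp [geodBegin, ideal, dotProduct, Fin.sum_univ_three]
    field_simp
    linarith
  have e2 : geodEnd x n ⬝ᵥ geodEnd x n = 1 := by
    simp [geodEnd, ideal, dotProduct, Fin.sum_univ_three]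
    field_simp
    linarith
  refine ⟨e1, e2, fun h => ?_⟩
  have e3 : geodBegin x n ⬝ᵥ geodEnd x n = 1 := by
    simp only at h
    rw [h]; exact e2
  simp [geodBegin, geodEnd, ideal, dotProduct, Fin.sum_univ_three] at e3
  field_simp at e3
  linarith

theorem tendsto_aux (A B c d : ℝ) (h : c + d ≠ 0) :
    Filter.Tendsto (fun r => (Real.cosh r * A + Real.sinh r * B) /
      (1 + (Real.cosh r * c + Real.sinh r * d))) Filter.atTop (nhds ((A + B) / (c + d))) := by
  have hexp : Filter.Tendsto (fun r : ℝ => Real.exp (-r)) Filter.atTop (nhds 0) :=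
    Real.tendsto_exp_neg_atTop_nhds_zero
  have hnum := ((hexp.pow 2).mul_const (A - B)).const_add (A + B)
  have hden := (((hexp.const_mul 2).const_add (c + d)).add ((hexp.pow 2).mul_const (c - d)))
  have := hnum.div hden (by simpa using h)
  simp only [ne_eq, OfNat.ofNat_ne_zero, not_false_eq_true, zero_pow, zero_mul, mul_zero,
    add_zero] at this
  refine this.congr fun r => ?_
  have hE : Real.exp (-r) * Real.exp r = 1 := by rw [← Real.exp_add]; simp
  have h2 : 2 * Real.exp (-r) ≠ 0 := by positivity
  rw [Real.cosh_eq, Real.sinh_eq, Pi.div_apply, ← mul_div_mul_left _ (1 + _) h2]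
  congr 1
  · linear_combination (-(A + B)) * hE
  · linear_combination (-(c + d)) * hE

theorem tendsto_geodEnd {x n : Mink} (hx : x ∈ hyp3) (hxn : lor x n = 0) (hn : lor n n = 1) :
    Filter.Tendsto (fun r => toBall (geod x n r)) Filter.atTop (nhds (geodEnd x n)) := by
  have h0 := (geod_aux hx hxn hn).2.ne'
  rw [tendsto_pi_nhds]
  intro i
  fin_cases i
  · simpa [toBall, geod, geodEnd, ideal] using tendsto_aux (x 1) (n 1) (x 0) (n 0) h0
  · simpa [toBall, geod, geodEnd, ideal] using tendsto_aux (x 2) (n 2) (x 0) (n 0) h0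
  · simpa [toBall, geod, geodEnd, ideal] using tendsto_aux (x 3) (n 3) (x 0) (n 0) h0

theorem tendsto_geodBegin {x n : Mink} (hx : x ∈ hyp3) (hxn : lor x n = 0) (hn : lor n n = 1) :
    Filter.Tendsto (fun r => toBall (geod x n r)) Filter.atBot (nhds (geodBegin x n)) := by
  have h := (tendsto_geodEnd (n := -n) hx (by simp [lor] at *; linarith)
    (by simpa [lor] using hn)).comp Filter.tendsto_neg_atBot_atTop
  simpa [Function.comp_def, geod, geodEnd, geodBegin, sub_eq_add_neg] using h

end HypSurface

end

/-! Let `a ≥ b` be the principal curvatures. The proof computes the induced metric in a principal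
frame, where it becomes a Lorentzian metric whose null directions are the principal directions.

The endpoints of the normal geodesic are the null directions `x - n` and `x + n`, and in Minkowski
terms the pulled-back metric is the symmetrization of `vol x n (dx v) (dn w)`
(`neutralMetric_normal`). At an umbilic `dn = c dx` and this vanishes, so non-degeneracy excludes
umbilics (`curvDisc_ne_zero`). The discriminant of the curvatures is then nonzero, so `a`, `b` and a
unit principal frame `X`, `Y` are of class `C²` (`contDiffAt_curv`, `exists_unit_principal`). In
particular the differentiability required by the Weingarten condition is automatic.

With the dual coframe `θ`, `η`, `dx = θ X + η Y` and `dn = a θ X + b η Y`, so the metric is `(b - a)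
θ η`. The Codazzi equations (`codazzi_coframe`) read `(b - a) dθ = da ∧ θ` and `(b - a) dη = -db ∧
η`. Hence the Levi-Civita connection acts on `θ` and `η` through the scalar forms `β = -da / (b -
a)` and `β' = db / (b - a)`: torsion-freeness is Codazzi, and compatibility is `β + β' = d log |b -
a|`. The curvature is given by `dβ = -da ∧ db / (b - a)²` and `dβ' = -dβ`, so the Gauss curvature is
a nowhere zero multiple of the coefficient of `da ∧ db` (`planeGaussCurvature_eq_zero_iff`). The
equivalence therefore holds point by point. -/

noncomputable section

namespace HypSurface

/-! ### Partial derivatives in the plane -/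

section PartialDerivatives

variable {F F' : E2 → ℝ} {u : E2}

theorem pd_congr (i : Fin 2) (h : F =ᶠ[nhds u] F') : pd i F u = pd i F' u := by
  simp only [pd, h.fderiv_eq]

theorem pd_add (i : Fin 2) (hF : DifferentiableAt ℝ F u) (hF' : DifferentiableAt ℝ F' u) :
    pd i (fun x => F x + F' x) u = pd i F u + pd i F' u := by
  simp [pd, fderiv_fun_add hF hF']

theorem pd_sub (i : Fin 2) (hF : DifferentiableAt ℝ F u) (hF' : DifferentiableAt ℝ F' u) :
    pd i (fun x => F x - F' x) u = pd i F u - pd i F' u := by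
  simp [pd, fderiv_fun_sub hF hF']

theorem pd_mul (i : Fin 2) (hF : DifferentiableAt ℝ F u) (hF' : DifferentiableAt ℝ F' u) :
    pd i (fun x => F x * F' x) u = pd i F u * F' u + F u * pd i F' u := by
  simp [pd, fderiv_fun_mul hF hF']
  ring

theorem pd_neg (i : Fin 2) : pd i (fun x => -F x) u = -pd i F u := by
  simp [pd, fderiv_fun_neg]

theorem contDiffAt_fderiv_apply {V : Type*} [NormedAddCommGroup V] [NormedSpace ℝ V] {F : E2 → V}
    {m n : WithTop ℕ∞} (hF : ContDiffAt ℝ n F u) (hmn : m + 1 ≤ n) (v : E2) :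
    ContDiffAt ℝ m (fun x => fderiv ℝ F x v) u :=
  (hF.fderiv_right hmn).clm_apply contDiffAt_const

theorem contDiffAt_pd {m n : WithTop ℕ∞} (hF : ContDiffAt ℝ n F u) (hmn : m + 1 ≤ n)
    (i : Fin 2) : ContDiffAt ℝ m (pd i F) u :=
  contDiffAt_fderiv_apply hF hmn _

theorem fderiv_fderiv_comm {V : Type*} [NormedAddCommGroup V] [NormedSpace ℝ V] {F : E2 → V}
    (hF : ContDiffAt ℝ 2 F u) (v w : E2) :
    fderiv ℝ (fun x => fderiv ℝ F x v) u w = fderiv ℝ (fun x => fderiv ℝ F x w) u v := by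
  have hd : DifferentiableAt ℝ (fderiv ℝ F) u :=
    (hF.fderiv_right (m := 1) (by norm_num)).differentiableAt (by norm_num)
  have hs : IsSymmSndFDerivAt ℝ F u := hF.isSymmSndFDerivAt (by simp)
  simp only [fderiv_clm_apply hd (differentiableAt_const _)]
  simpa using hs w v

theorem pd_comm (hF : ContDiffAt ℝ 2 F u) (i j : Fin 2) :
    pd i (pd j F) u = pd j (pd i F) u :=
  fderiv_fderiv_comm hF _ _

end PartialDerivatives

/-! ### Gauss curvature of a Lorentzian metric with a null coframe -/

/-- A torsion-free metric connection is the Levi-Civita connection. -/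
theorem christoffel_eq_of_compatible {g : E2 → Matrix (Fin 2) (Fin 2) ℝ} {u : E2}
    (hdet : (g u).det ≠ 0) (hsymm : ∀ i j, g u i j = g u j i)
    {Γ : Fin 2 → Fin 2 → Fin 2 → ℝ} (htor : ∀ l i j, Γ l i j = Γ l j i)
    (hcomp : ∀ k i j, pd k (fun x => g x i j) u = ∑ l, (Γ l k i * g u l j + Γ l k j * g u i l))
    (k i j : Fin 2) : christoffel g k i j u = Γ k i j := by
  have hinv : (g u)⁻¹ * g u = 1 := Matrix.nonsing_inv_mul _ (isUnit_iff_ne_zero.2 hdet)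
  -- The Koszul combination: after compatibility is inserted, symmetry of `Γ` cancels all terms but
  -- two equal ones.
  have key : ∀ l, pd i (fun x => g x j l) u + pd j (fun x => g x i l) u
      - pd l (fun x => g x i j) u = 2 * ∑ m, g u l m * Γ m i j := by
    intro l
    rw [hcomp, hcomp, hcomp]
    simp only [Fin.sum_univ_two]
    rw [htor 0 j i, htor 1 j i, htor 0 l i, htor 1 l i, htor 0 l j, htor 1 l j,
      hsymm l 0, hsymm l 1, hsymm j 0, hsymm j 1]
    ring
  have hk : ∀ m, ∑ l, (g u)⁻¹ k l * g u l m = if k = m then 1 else 0 := by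
    intro m
    rw [← Matrix.mul_apply, hinv, Matrix.one_apply]
  have h0 := hk 0
  have h1 := hk 1
  simp only [christoffel, key]
  simp only [Fin.sum_univ_two] at *
  have : Γ k i j = (if k = 0 then 1 else 0) * Γ 0 i j + (if k = 1 then 1 else 0) * Γ 1 i j := by
    fin_cases k <;> simp
  rw [this]
  linear_combination Γ 0 i j * h0 + Γ 1 i j * h1

/-- A coframe with inverse frame `e`, whose elements are parallel up to the connection forms `β`:
the curvature is diagonal. -/
theorem riemann_of_coframe {g : E2 → Matrix (Fin 2) (Fin 2) ℝ} {u : E2}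
    {θ : Fin 2 → E2 → ℝ} {β : Fin 2 → E2 → ℝ}
    (hθ : ∀ i, ContDiffAt ℝ 2 (θ i) u) (hβ : ∀ i, DifferentiableAt ℝ (β i) u)
    (hΓ : ∀ l i j, DifferentiableAt ℝ (christoffel g l i j) u)
    (h : ∀ᶠ x in nhds u, ∀ k i, ∑ l, θ l x * christoffel g l k i x
      = β k x * θ i x + pd k (θ i) x) (k i j : Fin 2) :
    ∑ l, θ l u * riemann g l k i j u = (pd i (β j) u - pd j (β i) u) * θ k u := by
  have hθ1 : ∀ i, DifferentiableAt ℝ (θ i) u := fun i => (hθ i).differentiableAt (by norm_num)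
  have hθ2 : ∀ i j, DifferentiableAt ℝ (pd i (θ j)) u := fun i j =>
    (contDiffAt_pd (hθ j) (m := 1) (by norm_num) i).differentiableAt (by norm_num)
  -- The defining relation of `β` is differentiated once. Antisymmetrizing in `i`, `j` will remove
  -- the second partials of `θ`.
  have hd : ∀ i j k, ∑ l, (pd i (θ l) u * christoffel g l j k u
      + θ l u * pd i (christoffel g l j k) u)
      = pd i (β j) u * θ k u + β j u * pd i (θ k) u + pd i (pd j (θ k)) u := by
    intro i j k
    have h1 := pd_congr i (h.mono fun x hx => hx j k)
    simp only [Fin.sum_univ_two] at h1 ⊢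
    rw [pd_add _ ((hθ1 0).fun_mul (hΓ 0 j k)) ((hθ1 1).fun_mul (hΓ 1 j k)),
      pd_mul _ (hθ1 0) (hΓ 0 j k), pd_mul _ (hθ1 1) (hΓ 1 j k),
      pd_add _ ((hβ j).fun_mul (hθ1 k)) (hθ2 j k), pd_mul _ (hβ j) (hθ1 k)] at h1
    linear_combination h1
  have hu := h.self_of_nhds
  have e1 := hd i j k
  have e2 := hd j i k
  have e3 := pd_comm (hθ k) i j
  have a1 := fun m => hu i m
  have a2 := fun m => hu j m
  simp only [riemann, Fin.sum_univ_two] at *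
  -- The quadratic Christoffel terms are contracted with `θ` twice. What survives is `β i * β j * θ
  -- k`, symmetric in `i`, `j`, and first-order terms that cancel against those of `e1 - e2`.
  linear_combination e1 - e2 + e3 + a1 0 * christoffel g 0 j k u + a1 1 * christoffel g 1 j k u
    - a2 0 * christoffel g 0 i k u - a2 1 * christoffel g 1 i k u + β i u * a2 k - β j u * a1 k

/-- A Lorentzian metric `(b - a) θ η` on a plane domain, whose null coframe satisfies
`(b - a) dθ = da ∧ θ` and `(b - a) dη = - db ∧ η`, is flat at exactly the points where
`da ∧ db = 0`. -/
theorem planeGaussCurvature_eq_zero_iff {g : E2 → Matrix (Fin 2) (Fin 2) ℝ} {u : E2}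
    {θ η : Fin 2 → E2 → ℝ} {a b : E2 → ℝ}
    (hθ : ∀ᶠ x in nhds u, ∀ i, ContDiffAt ℝ 2 (θ i) x)
    (hη : ∀ᶠ x in nhds u, ∀ i, ContDiffAt ℝ 2 (η i) x)
    (ha : ∀ᶠ x in nhds u, ContDiffAt ℝ 2 a x) (hb : ∀ᶠ x in nhds u, ContDiffAt ℝ 2 b x)
    (hab : ∀ᶠ x in nhds u, b x - a x ≠ 0)
    (hdet : ∀ᶠ x in nhds u, θ 0 x * η 1 x - θ 1 x * η 0 x ≠ 0)
    (hg : ∀ᶠ x in nhds u, ∀ i j, g x i j = (b x - a x) / 2 * (θ i x * η j x + η i x * θ j x))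
    (hdθ : ∀ᶠ x in nhds u, (b x - a x) * (pd 0 (θ 1) x - pd 1 (θ 0) x)
      = pd 0 a x * θ 1 x - pd 1 a x * θ 0 x)
    (hdη : ∀ᶠ x in nhds u, (b x - a x) * (pd 0 (η 1) x - pd 1 (η 0) x)
      = -(pd 0 b x * η 1 x - pd 1 b x * η 0 x)) :
    planeGaussCurvature g u = 0 ↔ pd 0 a u * pd 1 b u - pd 1 a u * pd 0 b u = 0 := by
  set f : E2 → ℝ := fun x => b x - a x with hf
  set δ : E2 → ℝ := fun x => θ 0 x * η 1 x - θ 1 x * η 0 x with hδ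
  -- The forms are chosen so that `dθ = -β ∧ θ`, `dη = -β' ∧ η` (no torsion) and `β + β' = df / f`
  -- (the metric `f θ η` is parallel).
  set β : Fin 2 → E2 → ℝ := fun k x => -(pd k a x / f x) with hβ
  set β' : Fin 2 → E2 → ℝ := fun k x => pd k b x / f x with hβ'
  -- The frame dual to `θ`, `η`, by Cramer's rule. It turns the values of `∇θ` and `∇η` into the
  -- candidate symbols `Γ`.
  set e : Fin 2 → E2 → ℝ := fun l x => ![η 1 x, -η 0 x] l / δ x with he
  set e' : Fin 2 → E2 → ℝ := fun l x => ![-θ 1 x, θ 0 x] l / δ x with he'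
  set Γ : Fin 2 → Fin 2 → Fin 2 → E2 → ℝ := fun l k i x =>
    e l x * (β k x * θ i x + pd k (θ i) x) + e' l x * (β' k x * η i x + pd k (η i) x) with hΓ
  -- An identity on a neighbourhood is needed, since the curvature differentiates the Christoffel
  -- symbols.
  have hchr : ∀ᶠ x in nhds u, ∀ l k i, christoffel g l k i x = Γ l k i x := by
    filter_upwards [hθ, hη, ha, hb, hab, hdet, hg.eventually_nhds, hdθ, hdη]
      with x hθ hη ha hb hab hdet hg hdθ hdη
    have hab' : f x ≠ 0 := hab
    have hdet' : δ x ≠ 0 := hdet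
    have hgx := hg.self_of_nhds
    have d1 : ∀ i, DifferentiableAt ℝ (θ i) x := fun i => (hθ i).differentiableAt (by norm_num)
    have d2 : ∀ i, DifferentiableAt ℝ (η i) x := fun i => (hη i).differentiableAt (by norm_num)
    have d3 : DifferentiableAt ℝ a x := ha.differentiableAt (by norm_num)
    have d4 : DifferentiableAt ℝ b x := hb.differentiableAt (by norm_num)
    have dual : ∀ k i, θ 0 x * Γ 0 k i x + θ 1 x * Γ 1 k i x = β k x * θ i x + pd k (θ i) x := by
      intro k i
      simp only [hΓ, he, he', Matrix.cons_val_zero, Matrix.cons_val_one]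
      field_simp
      simp only [hδ]
      ring
    have dual' : ∀ k i, η 0 x * Γ 0 k i x + η 1 x * Γ 1 k i x
        = β' k x * η i x + pd k (η i) x := by
      intro k i
      simp only [hΓ, he, he', Matrix.cons_val_zero, Matrix.cons_val_one]
      field_simp
      simp only [hδ]
      ring
    have hβf : ∀ k, β k x * f x = -pd k a x := by
      intro k
      simp only [hβ]
      field_simp
    have hβf' : ∀ k, β' k x * f x = pd k b x := by
      intro k
      simp only [hβ']
      field_simp
    have tor : β 0 x * θ 1 x + pd 0 (θ 1) x = β 1 x * θ 0 x + pd 1 (θ 0) x := by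
      apply mul_left_cancel₀ hab'
      linear_combination hdθ + θ 1 x * hβf 0 - θ 0 x * hβf 1
    have tor' : β' 0 x * η 1 x + pd 0 (η 1) x = β' 1 x * η 0 x + pd 1 (η 0) x := by
      apply mul_left_cancel₀ hab'
      linear_combination hdη + η 1 x * hβf' 0 - η 0 x * hβf' 1
    have tor01 : ∀ l, Γ l 0 1 x = Γ l 1 0 x := by
      intro l
      simp only [hΓ, tor, tor']
    intro l k i
    refine christoffel_eq_of_compatible (Γ := fun l k i => Γ l k i x) ?_ ?_ ?_ ?_ l k i
    · have hd : (g x).det = -(f x / 2 * δ x) ^ 2 := by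
        rw [Matrix.det_fin_two, hgx, hgx, hgx, hgx]
        simp only [hδ]
        ring
      rw [hd]
      exact neg_ne_zero.2 (pow_ne_zero 2 (mul_ne_zero (div_ne_zero hab' two_ne_zero) hdet'))
    · intro i j
      rw [hgx, hgx]
      ring
    · intro l i j
      fin_cases i <;> fin_cases j
      · rfl
      · exact tor01 l
      · exact (tor01 l).symm
      · rfl
    · intro k i j
      have hp : pd k (fun x => g x i j) x
          = (pd k b x - pd k a x) / 2 * (θ i x * η j x + η i x * θ j x)
            + f x / 2 * (pd k (θ i) x * η j x + θ i x * pd k (η j) x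
              + (pd k (η i) x * θ j x + η i x * pd k (θ j) x)) := by
        have e1 : (fun x => g x i j) =ᶠ[nhds x]
            fun x => (b x - a x) * (1 / 2 * (θ i x * η j x + η i x * θ j x)) := by
          filter_upwards [hg] with y hy
          rw [hy]
          ring
        have d5 := ((d1 i).fun_mul (d2 j)).fun_add ((d2 i).fun_mul (d1 j))
        rw [pd_congr k e1, pd_mul _ (d4.fun_sub d3) (d5.const_mul _), pd_sub _ d4 d3,
          pd_mul _ (differentiableAt_const _) d5,
          pd_add _ ((d1 i).fun_mul (d2 j)) ((d2 i).fun_mul (d1 j)), pd_mul _ (d1 i) (d2 j),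
          pd_mul _ (d2 i) (d1 j)]
        have : pd k (fun _ : E2 => (1 / 2 : ℝ)) x = 0 := by simp [pd]
        rw [this]
        simp only [hf]
        ring
      rw [hp, Fin.sum_univ_two]
      simp only [hgx]
      change _ = Γ 0 k i x * (f x / 2 * (θ 0 x * η j x + η 0 x * θ j x))
        + Γ 0 k j x * (f x / 2 * (θ i x * η 0 x + η i x * θ 0 x))
        + (Γ 1 k i x * (f x / 2 * (θ 1 x * η j x + η 1 x * θ j x))
        + Γ 1 k j x * (f x / 2 * (θ i x * η 1 x + η i x * θ 1 x)))
      linear_combination -(f x / 2 * η j x) * dual k i - (f x / 2 * θ j x) * dual' k i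
        - (f x / 2 * η i x) * dual k j - (f x / 2 * θ i x) * dual' k j
        - (θ i x * η j x + η i x * θ j x) / 2 * (hβf k + hβf' k)
  have cθ := hθ.self_of_nhds
  have cη := hη.self_of_nhds
  have ca := ha.self_of_nhds
  have cb := hb.self_of_nhds
  have hfu : f u ≠ 0 := hab.self_of_nhds
  have hδu : δ u ≠ 0 := hdet.self_of_nhds
  have d1 : ∀ i, DifferentiableAt ℝ (θ i) u := fun i => (cθ i).differentiableAt (by norm_num)
  have d2 : ∀ i, DifferentiableAt ℝ (η i) u := fun i => (cη i).differentiableAt (by norm_num)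
  have d3 : DifferentiableAt ℝ a u := ca.differentiableAt (by norm_num)
  have d4 : DifferentiableAt ℝ b u := cb.differentiableAt (by norm_num)
  have dpd : ∀ {F : E2 → ℝ}, ContDiffAt ℝ 2 F u → ∀ k, DifferentiableAt ℝ (pd k F) u :=
    fun hF k => (contDiffAt_pd hF (m := 1) (by norm_num) k).differentiableAt (by norm_num)
  have ddiv : ∀ {F G : E2 → ℝ}, DifferentiableAt ℝ F u → DifferentiableAt ℝ G u → G u ≠ 0 →
      DifferentiableAt ℝ (fun x => F x / G x) u := by
    intro F G hF hG h0
    simpa only [div_eq_mul_inv] using hF.fun_mul (hG.fun_inv h0)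
  have df : DifferentiableAt ℝ f u := d4.fun_sub d3
  have dβ : ∀ k, DifferentiableAt ℝ (β k) u := fun k =>
    (ddiv (dpd ca k) df hfu).fun_neg
  have dβ' : ∀ k, DifferentiableAt ℝ (β' k) u := fun k => ddiv (dpd cb k) df hfu
  have dδ : DifferentiableAt ℝ δ u := ((d1 0).fun_mul (d2 1)).fun_sub ((d1 1).fun_mul (d2 0))
  have de : ∀ l, DifferentiableAt ℝ (e l) u := by
    intro l
    refine ddiv ?_ dδ hδu
    fin_cases l
    · exact d2 1
    · exact (d2 0).fun_neg
  have de' : ∀ l, DifferentiableAt ℝ (e' l) u := by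
    intro l
    refine ddiv ?_ dδ hδu
    fin_cases l
    · exact (d1 1).fun_neg
    · exact d1 0
  have dchr : ∀ l i j, DifferentiableAt ℝ (christoffel g l i j) u := by
    intro l i j
    have h1 : DifferentiableAt ℝ (Γ l i j) u :=
      ((de l).fun_mul (((dβ i).fun_mul (d1 j)).fun_add (dpd (cθ j) i))).fun_add
        ((de' l).fun_mul (((dβ' i).fun_mul (d2 j)).fun_add (dpd (cη j) i)))
    exact h1.congr_of_eventuallyEq (hchr.mono fun x hx => hx l i j)
  have dual : ∀ᶠ x in nhds u, ∀ k i, ∑ l, θ l x * christoffel g l k i x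
      = β k x * θ i x + pd k (θ i) x := by
    filter_upwards [hchr, hdet] with x hx hdet k i
    have hdet' : δ x ≠ 0 := hdet
    rw [Fin.sum_univ_two, hx, hx]
    simp only [hΓ, he, he', Matrix.cons_val_zero, Matrix.cons_val_one]
    field_simp
    simp only [hδ]
    ring
  have dual' : ∀ᶠ x in nhds u, ∀ k i, ∑ l, η l x * christoffel g l k i x
      = β' k x * η i x + pd k (η i) x := by
    filter_upwards [hchr, hdet] with x hx hdet k i
    have hdet' : δ x ≠ 0 := hdet
    rw [Fin.sum_univ_two, hx, hx]
    simp only [hΓ, he, he', Matrix.cons_val_zero, Matrix.cons_val_one]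
    field_simp
    simp only [hδ]
    ring
  -- `planeGaussCurvature` uses only the components with lower indices `1 0 1`.
  have r := riemann_of_coframe cθ dβ dchr dual 1 0 1
  have r' := riemann_of_coframe cη dβ' dchr dual' 1 0 1
  have hβf : ∀ᶠ x in nhds u, ∀ k, β k x * f x = -pd k a x := by
    filter_upwards [hab] with x hab k
    have hab' : f x ≠ 0 := hab
    simp only [hβ]
    field_simp
  have hβf' : ∀ᶠ x in nhds u, ∀ k, β' k x * f x = pd k b x := by
    filter_upwards [hab] with x hab k
    have hab' : f x ≠ 0 := hab
    simp only [hβ']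
    field_simp
  have pf : ∀ j, pd j f u = pd j b u - pd j a u := fun j => pd_sub j d4 d3
  have q : ∀ j k, pd j (β k) u * f u + β k u * pd j f u = -pd j (pd k a) u := by
    intro j k
    have h1 := pd_congr j (hβf.mono fun x hx => hx k)
    rwa [pd_mul _ (dβ k) df, pd_neg (F := pd k a)] at h1
  have q' : ∀ j k, pd j (β' k) u * f u + β' k u * pd j f u = pd j (pd k b) u := by
    intro j k
    have h1 := pd_congr j (hβf'.mono fun x hx => hx k)
    rwa [pd_mul _ (dβ' k) df] at h1
  set J := pd 0 a u * pd 1 b u - pd 1 a u * pd 0 b u with hJ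
  have bu := hβf.self_of_nhds
  have bu' := hβf'.self_of_nhds
  -- `dβ = df ∧ da / f²` with `df = db - da`, so only the mixed term `-da ∧ db / f²` remains. The
  -- next identity is the analogue for `β'`.
  have c1 : (pd 0 (β 1) u - pd 1 (β 0) u) * f u ^ 2 = -J := by
    linear_combination f u * q 0 1 - f u * q 1 0 - f u * pd_comm ca 0 1 - pd 0 f u * bu 1
      + pd 1 f u * bu 0 + pd 1 a u * pf 0 - pd 0 a u * pf 1
  have c2 : (pd 0 (β' 1) u - pd 1 (β' 0) u) * f u ^ 2 = J := by
    linear_combination f u * q' 0 1 - f u * q' 1 0 + f u * pd_comm cb 0 1 - pd 0 f u * bu' 1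
      + pd 1 f u * bu' 0 - pd 1 b u * pf 0 + pd 0 b u * pf 1
  have hgu := hg.self_of_nhds
  have hd : (g u).det = -(f u / 2 * δ u) ^ 2 := by
    rw [Matrix.det_fin_two, hgu, hgu, hgu, hgu]
    simp only [hδ]
    ring
  have hd0 : (g u).det ≠ 0 := by
    rw [hd]
    exact neg_ne_zero.2 (pow_ne_zero 2 (mul_ne_zero (div_ne_zero hfu two_ne_zero) hδu))
  -- Lowering the index with `f θ η` pairs the `η` curvature with `θ 0` and the `θ` curvature with
  -- `η 0`. As `dβ' = -dβ`, the two products assemble into the determinant `δ`.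
  have hK : 2 * f u * (∑ l, g u 0 l * riemann g l 1 0 1 u) = δ u * J := by
    rw [Fin.sum_univ_two] at r r' ⊢
    rw [hgu, hgu]
    change 2 * f u * (f u / 2 * (θ 0 u * η 0 u + η 0 u * θ 0 u) * _
      + f u / 2 * (θ 0 u * η 1 u + η 0 u * θ 1 u) * _) = _
    simp only [hδ]
    linear_combination f u ^ 2 * (θ 0 u * r' + η 0 u * r) + θ 0 u * η 1 u * c2
      + η 0 u * θ 1 u * c1
  rw [planeGaussCurvature, div_eq_zero_iff, or_iff_left hd0]
  constructor
  · intro h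
    rw [h, mul_zero] at hK
    exact (mul_eq_zero.1 hK.symm).resolve_left hδu
  · intro h
    rw [h, mul_zero] at hK
    exact (mul_eq_zero.1 hK).resolve_left (mul_ne_zero two_ne_zero hfu)

/-! ### Linear algebra of Minkowski space -/

/-- The standard volume form of Minkowski space. -/
def vol (x y z w : Mink) : ℝ := (Matrix.of ![x, y, z, w]).det

theorem vol_eq (x y z w : Mink) : vol x y z w =
    x 0 * (y 1 * (z 2 * w 3 - z 3 * w 2) - y 2 * (z 1 * w 3 - z 3 * w 1)
        + y 3 * (z 1 * w 2 - z 2 * w 1))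
      - x 1 * (y 0 * (z 2 * w 3 - z 3 * w 2) - y 2 * (z 0 * w 3 - z 3 * w 0)
        + y 3 * (z 0 * w 2 - z 2 * w 0))
      + x 2 * (y 0 * (z 1 * w 3 - z 3 * w 1) - y 1 * (z 0 * w 3 - z 3 * w 0)
        + y 3 * (z 0 * w 1 - z 1 * w 0))
      - x 3 * (y 0 * (z 1 * w 2 - z 2 * w 1) - y 1 * (z 0 * w 2 - z 2 * w 0)
        + y 2 * (z 0 * w 1 - z 1 * w 0)) := by
  simp [vol, Matrix.det_succ_row_zero, Fin.sum_univ_succ, Fin.succAbove]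
  ring

theorem lor_comm (x y : Mink) : lor x y = lor y x := by
  simp only [lor]
  ring

theorem lor_add_left (x y z : Mink) : lor (x + y) z = lor x z + lor y z := by
  simp only [lor, Pi.add_apply]
  ring

theorem lor_add_right (x y z : Mink) : lor x (y + z) = lor x y + lor x z := by
  simp only [lor, Pi.add_apply]
  ring

theorem lor_sub_left (x y z : Mink) : lor (x - y) z = lor x z - lor y z := by
  simp only [lor, Pi.sub_apply]
  ring

theorem lor_sub_right (x y z : Mink) : lor x (y - z) = lor x y - lor x z := by
  simp only [lor, Pi.sub_apply]
  ring

theorem lor_smul_left (c : ℝ) (x y : Mink) : lor (c • x) y = c * lor x y := by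
  simp only [lor, Pi.smul_apply, smul_eq_mul]
  ring

theorem lor_smul_right (c : ℝ) (x y : Mink) : lor x (c • y) = c * lor x y := by
  simp only [lor, Pi.smul_apply, smul_eq_mul]
  ring

/-- Flipping the sign of the time coordinate of `v` turns the four products into one matrix-vector
product, and that matrix is invertible. -/
theorem eq_zero_of_lor_eq_zero {x y z w v : Mink} (h : vol x y z w ≠ 0) (hx : lor x v = 0)
    (hy : lor y v = 0) (hz : lor z v = 0) (hw : lor w v = 0) : v = 0 := by
  have h0 : Matrix.of ![x, y, z, w] *ᵥ ![-v 0, v 1, v 2, v 3] = 0 := by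
    simp only [lor] at hx hy hz hw
    funext i
    fin_cases i <;> simp [Matrix.mulVec, dotProduct, Fin.sum_univ_four] <;> linarith
  have h1 := Matrix.eq_zero_of_mulVec_eq_zero h h0
  funext i
  fin_cases i
  · simpa using congrFun h1 0
  · simpa using congrFun h1 1
  · simpa using congrFun h1 2
  · simpa using congrFun h1 3

/-- The Gram matrix is `A * diagonal ![-1, 1, 1, 1] * Aᵀ`; the Lorentzian signature accounts for the
minus sign. -/
theorem vol_sq (x y z w : Mink) : vol x y z w ^ 2 = -(Matrix.of
    ![![lor x x, lor x y, lor x z, lor x w], ![lor y x, lor y y, lor y z, lor y w],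
      ![lor z x, lor z y, lor z z, lor z w], ![lor w x, lor w y, lor w z, lor w w]]).det := by
  set A : Matrix (Fin 4) (Fin 4) ℝ := Matrix.of ![x, y, z, w] with hA
  have h : Matrix.of
    ![![lor x x, lor x y, lor x z, lor x w], ![lor y x, lor y y, lor y z, lor y w],
      ![lor z x, lor z y, lor z z, lor z w], ![lor w x, lor w y, lor w z, lor w w]]
      = A * Matrix.diagonal ![-1, 1, 1, 1] * Aᵀ := by
    ext i j
    rw [Matrix.mul_apply]
    simp only [Matrix.mul_diagonal, Fin.sum_univ_four]
    fin_cases i <;> fin_cases j <;> simp [lor, hA]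
  rw [h, Matrix.det_mul, Matrix.det_mul, Matrix.det_transpose, Matrix.det_diagonal]
  simp only [Fin.prod_univ_four, vol, ← hA]
  simp
  ring

/-- The orthogonal complement of a timelike vector is spacelike, by Cauchy–Schwarz on the spatial
parts. It makes the first fundamental form positive definite. -/
theorem lor_self_pos {x v : Mink} (hx : lor x x = -1) (hv : lor x v = 0) (h0 : v ≠ 0) :
    0 < lor v v := by
  have hne : 0 < v 1 ^ 2 + v 2 ^ 2 + v 3 ^ 2 := by
    by_contra hc
    have h1 : v 1 ^ 2 = 0 := by nlinarith [sq_nonneg (v 1), sq_nonneg (v 2), sq_nonneg (v 3)]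
    have h2 : v 2 ^ 2 = 0 := by nlinarith [sq_nonneg (v 1), sq_nonneg (v 2), sq_nonneg (v 3)]
    have h3 : v 3 ^ 2 = 0 := by nlinarith [sq_nonneg (v 1), sq_nonneg (v 2), sq_nonneg (v 3)]
    have e1 := pow_eq_zero_iff two_ne_zero |>.1 h1
    have e2 := pow_eq_zero_iff two_ne_zero |>.1 h2
    have e3 := pow_eq_zero_iff two_ne_zero |>.1 h3
    simp only [lor, e1, e2, e3] at hx hv
    have e0 : v 0 = 0 := by
      have h4 : x 0 ≠ 0 := by
        intro h
        rw [h] at hx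
        nlinarith [sq_nonneg (x 1), sq_nonneg (x 2), sq_nonneg (x 3)]
      have h5 : x 0 * v 0 = 0 := by linarith
      exact (mul_eq_zero.1 h5).resolve_left h4
    apply h0
    funext i
    fin_cases i <;> assumption
  simp only [lor] at *
  set s := v 1 ^ 2 + v 2 ^ 2 + v 3 ^ 2 with hs
  have a1 : x 0 * v 0 = x 1 * v 1 + x 2 * v 2 + x 3 * v 3 := by linarith
  have cs : (x 0 * v 0) ^ 2 ≤ (x 0 ^ 2 - 1) * s := by
    have a2 : x 0 ^ 2 - 1 = x 1 ^ 2 + x 2 ^ 2 + x 3 ^ 2 := by linarith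
    rw [a1, a2, hs]
    linarith [sq_nonneg (x 1 * v 2 - x 2 * v 1), sq_nonneg (x 1 * v 3 - x 3 * v 1),
      sq_nonneg (x 2 * v 3 - x 3 * v 2)]
  have hp : 0 < x 0 ^ 2 * (s - v 0 ^ 2) := by linarith
  have := pos_of_mul_pos_right hp (sq_nonneg _)
  linarith

/-- The vector product of three vectors of Minkowski space. -/
def cross3 (x y z : Mink) : Mink :=
  ![vol x (Pi.single 0 1) y z * -1, vol x (Pi.single 1 1) y z, vol x (Pi.single 2 1) y z,
    vol x (Pi.single 3 1) y z]

/-- The factor `-1` in the time component of `cross3` offsets the sign in `lor`, so that the vector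
product is dual to `vol`. -/
theorem lor_cross3 (x y z v : Mink) : lor (cross3 x y z) v = vol x v y z := by
  simp [cross3, lor, vol_eq]
  ring

/-! ### First order data of an oriented surface in hyperbolic space -/

/-- The tangential data at a point of a surface in hyperbolic space: the position `x`, the unit
normal `n`, and the partial derivatives `dx` of the position. -/
structure TangentJet (x n : Mink) (dx : Fin 2 → Mink) : Prop where
  xx : lor x x = -1
  xn : lor x n = 0
  nn : lor n n = 1
  x_dx : ∀ i, lor x (dx i) = 0
  n_dx : ∀ i, lor n (dx i) = 0
  indep : ∀ c : Fin 2 → ℝ, c 0 • dx 0 + c 1 • dx 1 = 0 → c = 0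

/-- The first order data at a point of a surface in hyperbolic space: the position `x`, the unit
normal `n`, and their partial derivatives `dx`, `dn`. -/
structure SurfaceJet (x n : Mink) (dx dn : Fin 2 → Mink) : Prop extends TangentJet x n dx where
  x_dn : ∀ i, lor x (dn i) = 0
  n_dn : ∀ i, lor n (dn i) = 0
  second_symm : lor (dn 0) (dx 1) = lor (dn 1) (dx 0)

/-- The determinant of the first fundamental form. -/
def gramDet (dx : Fin 2 → Mink) : ℝ :=
  lor (dx 0) (dx 0) * lor (dx 1) (dx 1) - lor (dx 0) (dx 1) ^ 2

/-- The sum of the principal curvatures. -/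
def curvSum (dx dn : Fin 2 → Mink) : ℝ :=
  (lor (dx 0) (dx 0) * lor (dn 1) (dx 1) - 2 * lor (dx 0) (dx 1) * lor (dn 0) (dx 1)
    + lor (dx 1) (dx 1) * lor (dn 0) (dx 0)) / gramDet dx

/-- The product of the principal curvatures. -/
def curvProd (dx dn : Fin 2 → Mink) : ℝ :=
  (lor (dn 0) (dx 0) * lor (dn 1) (dx 1) - lor (dn 0) (dx 1) ^ 2) / gramDet dx

/-- The squared difference of the principal curvatures. -/
def curvDisc (dx dn : Fin 2 → Mink) : ℝ := curvSum dx dn ^ 2 - 4 * curvProd dx dn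

/-- The larger principal curvature. -/
def curvMax (dx dn : Fin 2 → Mink) : ℝ := (curvSum dx dn + √(curvDisc dx dn)) / 2

/-- The smaller principal curvature. -/
def curvMin (dx dn : Fin 2 → Mink) : ℝ := (curvSum dx dn - √(curvDisc dx dn)) / 2

theorem lor_comb_comb (a b c d : ℝ) (x y z w : Mink) :
    lor (a • x + b • y) (c • z + d • w)
      = a * c * lor x z + a * d * lor x w + b * c * lor y z + b * d * lor y w := by
  simp only [lor_add_left, lor_add_right, lor_smul_left, lor_smul_right]
  ring

theorem vol_comb_comb (a b c d : ℝ) (x n y z : Mink) :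
    vol x n (a • y + b • z) (c • y + d • z) = (a * d - b * c) * vol x n y z := by
  simp only [vol_eq, Pi.add_apply, Pi.smul_apply, smul_eq_mul]
  ring

namespace TangentJet

variable {x n : Mink} {dx : Fin 2 → Mink}

theorem gram_pos (J : TangentJet x n dx) {c : Fin 2 → ℝ} (hc : c ≠ 0) :
    0 < c 0 ^ 2 * lor (dx 0) (dx 0) + 2 * c 0 * c 1 * lor (dx 0) (dx 1)
      + c 1 ^ 2 * lor (dx 1) (dx 1) := by
  have h := lor_self_pos J.xx (v := c 0 • dx 0 + c 1 • dx 1)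
    (by rw [lor_add_right, lor_smul_right, lor_smul_right, J.x_dx, J.x_dx]; ring)
    (fun h => hc (J.indep c h))
  rw [lor_comb_comb, lor_comm (dx 1) (dx 0)] at h
  linarith

theorem gram_zero_pos (J : TangentJet x n dx) : 0 < lor (dx 0) (dx 0) := by
  simpa using J.gram_pos (c := ![1, 0]) (fun h => by simpa using congrFun h 0)

theorem gramDet_pos (J : TangentJet x n dx) : 0 < gramDet dx := by
  have h0 := J.gram_zero_pos
  -- On the vector `(-F, E)` the first fundamental form takes the value `E (E G - F²)`.
  have h := J.gram_pos (c := ![-lor (dx 0) (dx 1), lor (dx 0) (dx 0)])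
    (fun h => h0.ne' (by simpa using congrFun h 1))
  simp only [Matrix.cons_val_zero, Matrix.cons_val_one] at h
  have e : lor (dx 0) (dx 0) * gramDet dx > 0 := by
    simp only [gramDet]
    linarith
  exact pos_of_mul_pos_right e h0.le

/-- The Gram matrix of `x, n, dx 0, dx 1` is block diagonal with blocks `-1`, `1` and the first
fundamental form. -/
theorem vol_sq (J : TangentJet x n dx) : vol x n (dx 0) (dx 1) ^ 2 = gramDet dx := by
  rw [HypSurface.vol_sq, lor_comm n x, lor_comm (dx 0) x, lor_comm (dx 1) x, lor_comm (dx 0) n,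
    lor_comm (dx 1) n,
    J.xx, J.xn, J.nn, J.x_dx, J.x_dx, J.n_dx, J.n_dx, lor_comm (dx 1) (dx 0)]
  simp [Matrix.det_succ_row_zero, Fin.sum_univ_succ, Fin.succAbove, gramDet]
  ring

theorem vol_ne (J : TangentJet x n dx) : vol x n (dx 0) (dx 1) ≠ 0 := by
  intro h
  have h1 := J.vol_sq
  rw [h] at h1
  have h2 := J.gramDet_pos
  norm_num at h1
  linarith

/-- A vector orthogonal to `x` and `n` is determined by its products with the tangent vectors. -/
theorem ext_tangent (J : TangentJet x n dx) {v w : Mink} (h1 : lor x v = lor x w)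
    (h2 : lor n v = lor n w) (h3 : ∀ i, lor (dx i) v = lor (dx i) w) : v = w := by
  rw [← sub_eq_zero]
  apply eq_zero_of_lor_eq_zero J.vol_ne <;> rw [lor_sub_right, sub_eq_zero]
  · exact h1
  · exact h2
  · exact h3 0
  · exact h3 1

/-- The normal is determined by the vector product. -/
theorem cross3_eq (J : TangentJet x n dx) :
    cross3 x (dx 0) (dx 1) = vol x n (dx 0) (dx 1) • n := by
  apply J.ext_tangent
  · rw [lor_comm, lor_cross3, lor_smul_right, J.xn, vol_eq]
    ring
  · rw [lor_comm, lor_cross3, lor_smul_right, J.nn, mul_one]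
  · intro i
    rw [lor_comm, lor_cross3, lor_smul_right, lor_comm, J.n_dx, mul_zero, vol_eq]
    fin_cases i <;> simp <;> ring

end TangentJet

/-! ### Principal curvatures and principal frames at a point -/

namespace SurfaceJet

variable {x n : Mink} {dx dn : Fin 2 → Mink}

/-- With `E, F, G` and `L, M, N` the coefficients of the two fundamental forms, the discriminant is,
up to a positive factor, a sum of two squares with positive weights. This gives its sign, and shows
that it vanishes only if `E M = F L` and `E N = G L`. -/
theorem curvDisc_eq (J : SurfaceJet x n dx dn) :
    lor (dx 0) (dx 0) ^ 2 * gramDet dx ^ 2 * curvDisc dx dn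
      = (lor (dx 0) (dx 0) * (lor (dx 0) (dx 0) * lor (dn 1) (dx 1)
          - lor (dx 1) (dx 1) * lor (dn 0) (dx 0)) - 2 * lor (dx 0) (dx 1)
          * (lor (dx 0) (dx 0) * lor (dn 0) (dx 1) - lor (dx 0) (dx 1) * lor (dn 0) (dx 0))) ^ 2
        + 4 * gramDet dx * (lor (dx 0) (dx 0) * lor (dn 0) (dx 1)
          - lor (dx 0) (dx 1) * lor (dn 0) (dx 0)) ^ 2 := by
  have h0 := J.gram_zero_pos
  have h1 := J.gramDet_pos
  simp only [curvDisc, curvSum, curvProd]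
  field_simp
  simp only [gramDet]
  ring

theorem curvDisc_nonneg (J : SurfaceJet x n dx dn) : 0 ≤ curvDisc dx dn := by
  have h0 := J.gram_zero_pos
  have h1 := J.gramDet_pos
  have h := J.curvDisc_eq
  have h2 : 0 ≤ lor (dx 0) (dx 0) ^ 2 * gramDet dx ^ 2 * curvDisc dx dn := by
    rw [h]
    positivity
  exact nonneg_of_mul_nonneg_right h2 (by positivity)

theorem umbilic_of_curvDisc_eq_zero (J : SurfaceJet x n dx dn) (hd : curvDisc dx dn = 0) :
    ∃ c : ℝ, ∀ i, dn i = c • dx i := by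
  have h0 := J.gram_zero_pos
  have h1 := J.gramDet_pos
  have h := J.curvDisc_eq
  rw [hd, mul_zero] at h
  set p := lor (dx 0) (dx 0) * lor (dn 0) (dx 1) - lor (dx 0) (dx 1) * lor (dn 0) (dx 0) with hp
  set q := lor (dx 0) (dx 0) * lor (dn 1) (dx 1) - lor (dx 1) (dx 1) * lor (dn 0) (dx 0) with hq
  have hp0 : p = 0 := by
    have : 4 * gramDet dx * p ^ 2 = 0 := by
      nlinarith [sq_nonneg (lor (dx 0) (dx 0) * q - 2 * lor (dx 0) (dx 1) * p),
        mul_nonneg h1.le (sq_nonneg p)]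
    simpa [h1.ne'] using this
  have hq0 : q = 0 := by
    rw [hp0] at h
    have : (lor (dx 0) (dx 0) * q) ^ 2 = 0 := by linarith
    simpa [h0.ne'] using this
  -- The two forms are proportional with ratio `L / E`. Since every `dn i` is tangent, this lifts to
  -- the vectors themselves.
  refine ⟨lor (dn 0) (dx 0) / lor (dx 0) (dx 0), fun i => ?_⟩
  apply J.ext_tangent
  · rw [lor_smul_right, J.x_dn, J.x_dx, mul_zero]
  · rw [lor_smul_right, J.n_dn, J.n_dx, mul_zero]
  · intro j
    rw [lor_smul_right, lor_comm (dx j) (dn i)]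
    have hs := J.second_symm
    have hc := lor_comm (dx 1) (dx 0)
    field_simp
    fin_cases i <;> fin_cases j <;> simp only [Fin.zero_eta, Fin.mk_one] <;>
      (try rw [hc]) <;> (try rw [← hs]) <;> linarith

/-- The characteristic polynomial of the second fundamental form. -/
theorem four_mul_det_pencil (J : SurfaceJet x n dx dn) (c : ℝ) :
    4 * ((lor (dn 0) (dx 0) - c * lor (dx 0) (dx 0)) * (lor (dn 1) (dx 1) - c * lor (dx 1) (dx 1))
      - (lor (dn 0) (dx 1) - c * lor (dx 0) (dx 1)) ^ 2)
    = gramDet dx * ((2 * c - curvSum dx dn) ^ 2 - curvDisc dx dn) := by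
  have h1 := J.gramDet_pos
  simp only [curvDisc, curvSum, curvProd]
  field_simp
  simp only [gramDet]
  ring

/-- The principal curvatures are the eigenvalues of the second fundamental form. -/
theorem exists_eigenvector_iff (J : SurfaceJet x n dx dn) (c : ℝ) :
    (∃ v : Fin 2 → ℝ, v ≠ 0 ∧ ∀ j, v 0 * lor (dn 0) (dx j) + v 1 * lor (dn 1) (dx j)
      = c * (v 0 * lor (dx 0) (dx j) + v 1 * lor (dx 1) (dx j)))
    ↔ c = curvMax dx dn ∨ c = curvMin dx dn := by
  have h1 := J.gramDet_pos
  have hs := J.second_symm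
  have hc := lor_comm (dx 1) (dx 0)
  set A : Matrix (Fin 2) (Fin 2) ℝ :=
    Matrix.of fun j i => lor (dn i) (dx j) - c * lor (dx i) (dx j) with hA
  have e1 : ∀ v : Fin 2 → ℝ, A *ᵥ v = 0 ↔
      ∀ j, v 0 * lor (dn 0) (dx j) + v 1 * lor (dn 1) (dx j)
      = c * (v 0 * lor (dx 0) (dx j) + v 1 * lor (dx 1) (dx j)) := by
    intro v
    rw [funext_iff]
    refine forall_congr' fun j => ?_
    simp only [Matrix.mulVec, dotProduct, Fin.sum_univ_two, hA, Matrix.of_apply, Pi.zero_apply]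
    constructor <;> intro h <;> linarith
  simp only [← e1]
  rw [Matrix.exists_mulVec_eq_zero_iff]
  have e2 : 4 * A.det = gramDet dx * ((2 * c - curvSum dx dn) ^ 2 - curvDisc dx dn) := by
    rw [← J.four_mul_det_pencil, Matrix.det_fin_two]
    simp only [hA, Matrix.of_apply]
    rw [hc, ← hs]
    ring
  have e3 : A.det = 0 ↔ (2 * c - curvSum dx dn) ^ 2 = √(curvDisc dx dn) ^ 2 := by
    rw [Real.sq_sqrt J.curvDisc_nonneg]
    constructor
    · intro h
      rw [h, mul_zero] at e2
      have := (mul_eq_zero.1 e2.symm).resolve_left h1.ne'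
      linarith
    · intro h
      rw [h, sub_self, mul_zero] at e2
      linarith
  rw [e3, sq_eq_sq_iff_eq_or_eq_neg]
  simp only [curvMax, curvMin]
  constructor <;> rintro (h | h)
  · left; linarith
  · right; linarith
  · left; linarith
  · right; linarith

/-- The adapted orthonormal frame spanned by a unit principal vector. -/
theorem principal_frame (J : SurfaceJet x n dx dn) {e : Fin 2 → ℝ} {X Y : Mink}
    (he : ∀ j, e 0 * lor (dn 0) (dx j) + e 1 * lor (dn 1) (dx j)
      = curvMax dx dn * (e 0 * lor (dx 0) (dx j) + e 1 * lor (dx 1) (dx j)))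
    (hX : X = e 0 • dx 0 + e 1 • dx 1) (hXX : lor X X = 1)
    (hY : Y = (vol x n (dx 0) (dx 1))⁻¹ • (lor (dx 0) X • dx 1 - lor (dx 1) X • dx 0)) :
    lor Y Y = 1 ∧ lor X Y = 0 ∧ vol x n X Y = 1 ∧
      (∀ i, dx i = lor (dx i) X • X + lor (dx i) Y • Y) ∧
      ∀ i, dn i = (curvMax dx dn * lor (dx i) X) • X + (curvMin dx dn * lor (dx i) Y) • Y := by
  have hc := lor_comm (dx 1) (dx 0)
  have hs := J.second_symm
  have hD := J.gramDet_pos.ne'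
  have hW := J.vol_ne
  have hW2 := J.vol_sq
  have h0 := he 0
  have h1 := he 1
  have htr : lor (dx 0) (dx 0) * lor (dn 1) (dx 1) - 2 * lor (dx 0) (dx 1) * lor (dn 0) (dx 1)
      + lor (dx 1) (dx 1) * lor (dn 0) (dx 0)
      = (curvMax dx dn + curvMin dx dn) * gramDet dx := by
    have : curvMax dx dn + curvMin dx dn = curvSum dx dn := by
      simp only [curvMax, curvMin]
      ring
    rw [this, curvSum, div_mul_cancel₀ _ hD]
  have hθ0 : lor (dx 0) X = e 0 * lor (dx 0) (dx 0) + e 1 * lor (dx 0) (dx 1) := by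
    rw [hX, lor_add_right, lor_smul_right, lor_smul_right]
  have hθ1 : lor (dx 1) X = e 0 * lor (dx 0) (dx 1) + e 1 * lor (dx 1) (dx 1) := by
    rw [hX, lor_add_right, lor_smul_right, lor_smul_right, hc]
  have hunit : e 0 * lor (dx 0) X + e 1 * lor (dx 1) X = 1 := by
    rw [← hXX]
    nth_rewrite 3 [hX]
    rw [lor_add_left, lor_smul_left, lor_smul_left]
  have hη : ∀ z, lor z Y = (vol x n (dx 0) (dx 1))⁻¹
      * (lor (dx 0) X * lor z (dx 1) - lor (dx 1) X * lor z (dx 0)) := by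
    intro z
    rw [hY, lor_smul_right, lor_sub_right, lor_smul_right, lor_smul_right]
  -- In coordinates `Y` is dual to the covector `W (-e 1, e 0)` with `W` the volume: the unit
  -- covector that annihilates `X`.
  have hη0 : lor (dx 0) Y = -(vol x n (dx 0) (dx 1) * e 1) := by
    rw [hη, hθ0, hθ1, inv_mul_eq_iff_eq_mul₀ hW]
    rw [gramDet] at hW2
    linear_combination e 1 * hW2
  have hη1 : lor (dx 1) Y = vol x n (dx 0) (dx 1) * e 0 := by
    rw [hη, hθ0, hθ1, hc, inv_mul_eq_iff_eq_mul₀ hW]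
    rw [gramDet] at hW2
    linear_combination -e 0 * hW2
  have hXY : lor X Y = 0 := by
    rw [hη, lor_comm X (dx 1), lor_comm X (dx 0)]
    ring
  have hYY : lor Y Y = 1 := by
    rw [hη, lor_comm Y, lor_comm Y, hη0, hη1, inv_mul_eq_iff_eq_mul₀ hW]
    linear_combination vol x n (dx 0) (dx 1) * hunit
  have hxX : lor x X = 0 := by
    rw [hX, lor_add_right, lor_smul_right, lor_smul_right, J.x_dx, J.x_dx]
    ring
  have hnX : lor n X = 0 := by
    rw [hX, lor_add_right, lor_smul_right, lor_smul_right, J.n_dx, J.n_dx]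
    ring
  have hxY : lor x Y = 0 := by
    rw [hη, J.x_dx, J.x_dx]
    ring
  have hnY : lor n Y = 0 := by
    rw [hη, J.n_dx, J.n_dx]
    ring
  have hvol : vol x n X Y = 1 := by
    have e1 : Y = (-((vol x n (dx 0) (dx 1))⁻¹ * lor (dx 1) X)) • dx 0
        + ((vol x n (dx 0) (dx 1))⁻¹ * lor (dx 0) X) • dx 1 := by
      rw [hY]
      module
    rw [e1, hX, vol_comb_comb, ← hX]
    field_simp
    linear_combination hunit
  have hself : ∀ i j, lor (dx j) (dx i)
      = lor (dx i) X * lor (dx j) X + lor (dx i) Y * lor (dx j) Y := by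
    have a00 : lor (dx 0) (dx 0) = lor (dx 0) X * lor (dx 0) X + lor (dx 0) Y * lor (dx 0) Y := by
      have hη0' := hη (dx 0)
      field_simp at hη0'
      rw [hη0] at hη0' ⊢
      linear_combination (-lor (dx 0) (dx 0)) * hunit - lor (dx 0) X * hθ0 + e 1 * hη0'
    have a01 : lor (dx 0) (dx 1) = lor (dx 0) X * lor (dx 1) X + lor (dx 0) Y * lor (dx 1) Y := by
      have hη0' := hη (dx 1)
      field_simp at hη0'
      rw [hc] at hη0'
      rw [hη0]
      linear_combination (-lor (dx 0) (dx 1)) * hunit - lor (dx 0) X * hθ1 + e 1 * hη0'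
    have a11 : lor (dx 1) (dx 1) = lor (dx 1) X * lor (dx 1) X + lor (dx 1) Y * lor (dx 1) Y := by
      have hη0' := hη (dx 1)
      field_simp at hη0'
      rw [hc] at hη0'
      rw [hη1] at hη0' ⊢
      linear_combination (-lor (dx 1) (dx 1)) * hunit - lor (dx 1) X * hθ1 - e 0 * hη0'
    intro i j
    fin_cases i <;> fin_cases j <;> simp only [Fin.zero_eta, Fin.mk_one]
    · exact a00
    · rw [hc, a01]
    · rw [a01]
      ring
    · exact a11
  have hsecond : ∀ i j, lor (dx j) (dn i) = curvMax dx dn * lor (dx i) X * lor (dx j) X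
      + curvMin dx dn * lor (dx i) Y * lor (dx j) Y := by
    rw [← hs] at h0
    rw [hc, ← hθ0] at h0
    rw [← hθ1] at h1
    generalize hp : lor (dx 0) X = p at *
    generalize hq : lor (dx 1) X = q at *
    generalize curvMax dx dn = k at *
    generalize curvMin dx dn = k' at *
    -- Eliminating the eigenvalue shows that `e` annihilates the covector of `e1` and `e2` below.
    -- That covector is thus a multiple of `(e 1, -e 0)`, and `τ` is the factor: the value of the
    -- second form on `(q, -p)`.
    have eA : e 0 * (lor (dn 0) (dx 0) * q - lor (dn 0) (dx 1) * p)
        + e 1 * (lor (dn 0) (dx 1) * q - lor (dn 1) (dx 1) * p) = 0 := by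
      linear_combination q * h0 - p * h1
    set τ := lor (dn 0) (dx 0) * q ^ 2 - 2 * lor (dn 0) (dx 1) * p * q + lor (dn 1) (dx 1) * p ^ 2
      with hτ
    have e1 : lor (dn 0) (dx 0) * q - lor (dn 0) (dx 1) * p = e 1 * τ := by
      rw [hτ]
      linear_combination p * eA - (lor (dn 0) (dx 0) * q - lor (dn 0) (dx 1) * p) * hunit
    have e2 : lor (dn 0) (dx 1) * q - lor (dn 1) (dx 1) * p = -(e 0 * τ) := by
      rw [hτ]
      linear_combination q * eA - (lor (dn 0) (dx 1) * q - lor (dn 1) (dx 1) * p) * hunit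
    have hL : lor (dn 0) (dx 0) = k * p ^ 2 + τ * e 1 ^ 2 := by
      linear_combination p * h0 + e 1 * e1 - lor (dn 0) (dx 0) * hunit
    have hM : lor (dn 0) (dx 1) = k * p * q - τ * e 0 * e 1 := by
      linear_combination p * h1 + e 1 * e2 - lor (dn 0) (dx 1) * hunit
    have hN : lor (dn 1) (dx 1) = k * q ^ 2 + τ * e 0 ^ 2 := by
      linear_combination q * h1 - e 0 * e2 - lor (dn 1) (dx 1) * hunit
    -- The eigenvector equation determines the second form up to `τ`. The trace relation `htr` fixes
    -- it as the other curvature times the Gram determinant.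
    have hτD : τ = k' * gramDet dx := by
      have e3 : lor (dx 0) (dx 0) * q ^ 2 - 2 * lor (dx 0) (dx 1) * p * q
          + lor (dx 1) (dx 1) * p ^ 2 = gramDet dx := by
        rw [gramDet]
        linear_combination (lor (dx 0) (dx 0) * lor (dx 1) (dx 1) - lor (dx 0) (dx 1) ^ 2) * hunit
          + (lor (dx 1) (dx 1) * p - lor (dx 0) (dx 1) * q) * hθ0
          + (lor (dx 0) (dx 0) * q - lor (dx 0) (dx 1) * p) * hθ1
      have e4 : lor (dx 0) (dx 0) * e 0 ^ 2 + 2 * lor (dx 0) (dx 1) * e 0 * e 1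
          + lor (dx 1) (dx 1) * e 1 ^ 2 = 1 := by
        linear_combination hunit - e 0 * hθ0 - e 1 * hθ1
      linear_combination htr - lor (dx 0) (dx 0) * hN + 2 * lor (dx 0) (dx 1) * hM
        - lor (dx 1) (dx 1) * hL - k * e3 - τ * e4
    rw [hτD, ← hW2] at hL hM hN
    intro i j
    fin_cases i <;> fin_cases j <;> simp only [Fin.zero_eta, Fin.mk_one]
    · rw [lor_comm, hp, hη0]
      linear_combination hL
    · rw [lor_comm, hp, hq, hη0, hη1]
      linear_combination hM
    · rw [lor_comm, hp, hq, hη0, hη1, ← hs]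
      linear_combination hM
    · rw [lor_comm, hq, hη1]
      linear_combination hN
  refine ⟨hYY, hXY, hvol, fun i => ?_, fun i => ?_⟩
  · apply J.ext_tangent
    · simp only [lor_add_right, lor_smul_right, hxX, hxY, J.x_dx]
      ring
    · simp only [lor_add_right, lor_smul_right, hnX, hnY, J.n_dx]
      ring
    · intro j
      rw [lor_add_right, lor_smul_right, lor_smul_right, hself]
  · apply J.ext_tangent
    · simp only [lor_add_right, lor_smul_right, hxX, hxY, J.x_dn]
      ring
    · simp only [lor_add_right, lor_smul_right, hnX, hnY, J.n_dn]
      ring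
    · intro j
      rw [lor_add_right, lor_smul_right, lor_smul_right, hsecond]

end SurfaceJet

/-! ### Local parametrizations of surfaces -/

section Calculus

variable {X Y Z W : E2 → Mink} {u : E2} {k : WithTop ℕ∞}

/-- The partial derivatives of a map into Minkowski space. -/
def partials (X : E2 → Mink) (u : E2) (i : Fin 2) : Mink := fderiv ℝ X u (cvec i)

theorem partials_apply (hX : DifferentiableAt ℝ X u) (i : Fin 2) (a : Fin 4) :
    partials X u i a = pd i (fun y => X y a) u := by
  rw [partials, fderiv_pi (differentiableAt_pi.1 hX)]
  rfl

theorem contDiffAt_partials {m : WithTop ℕ∞} (hX : ContDiffAt ℝ k X u) (hm : m + 1 ≤ k)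
    (i : Fin 2) : ContDiffAt ℝ m (fun y => partials X y i) u :=
  contDiffAt_fderiv_apply hX hm _

theorem partials_partials_comm (hX : ContDiffAt ℝ 2 X u) (i j : Fin 2) :
    partials (fun y => partials X y i) u j = partials (fun y => partials X y j) u i :=
  fderiv_fderiv_comm hX _ _

theorem contDiffAt_lor (hX : ContDiffAt ℝ k X u) (hY : ContDiffAt ℝ k Y u) :
    ContDiffAt ℝ k (fun y => lor (X y) (Y y)) u := by
  have hX' := contDiffAt_pi.1 hX
  have hY' := contDiffAt_pi.1 hY
  exact ((((hX' 0).mul (hY' 0)).neg.add ((hX' 1).mul (hY' 1))).add ((hX' 2).mul (hY' 2))).add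
    ((hX' 3).mul (hY' 3))

theorem pd_lor (hX : DifferentiableAt ℝ X u) (hY : DifferentiableAt ℝ Y u) (i : Fin 2) :
    pd i (fun y => lor (X y) (Y y)) u = lor (partials X u i) (Y u) + lor (X u) (partials Y u i) := by
  have hX' := differentiableAt_pi.1 hX
  have hY' := differentiableAt_pi.1 hY
  have m : ∀ a, DifferentiableAt ℝ (fun y => X y a * Y y a) u := fun a => (hX' a).fun_mul (hY' a)
  simp only [lor, partials_apply hX, partials_apply hY]
  rw [pd_add _ (((m 0).fun_neg.fun_add (m 1)).fun_add (m 2)) (m 3),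
    pd_add _ ((m 0).fun_neg.fun_add (m 1)) (m 2), pd_add _ (m 0).fun_neg (m 1),
    pd_neg (F := fun y => X y 0 * Y y 0), pd_mul _ (hX' 0) (hY' 0), pd_mul _ (hX' 1) (hY' 1),
    pd_mul _ (hX' 2) (hY' 2), pd_mul _ (hX' 3) (hY' 3)]
  ring

theorem contDiffAt_vol (hX : ContDiffAt ℝ k X u) (hY : ContDiffAt ℝ k Y u)
    (hZ : ContDiffAt ℝ k Z u) (hW : ContDiffAt ℝ k W u) :
    ContDiffAt ℝ k (fun y => vol (X y) (Y y) (Z y) (W y)) u := by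
  have hX' := contDiffAt_pi.1 hX
  have hY' := contDiffAt_pi.1 hY
  have hZ' := contDiffAt_pi.1 hZ
  have hW' := contDiffAt_pi.1 hW
  simp only [vol_eq]
  fun_prop

theorem contDiffAt_cross3 (hX : ContDiffAt ℝ k X u) (hY : ContDiffAt ℝ k Y u)
    (hZ : ContDiffAt ℝ k Z u) : ContDiffAt ℝ k (fun y => cross3 (X y) (Y y) (Z y)) u := by
  rw [contDiffAt_pi]
  intro a
  fin_cases a
  · exact (contDiffAt_vol hX contDiffAt_const hY hZ).mul contDiffAt_const
  · exact contDiffAt_vol hX contDiffAt_const hY hZ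
  · exact contDiffAt_vol hX contDiffAt_const hY hZ
  · exact contDiffAt_vol hX contDiffAt_const hY hZ

/-- The product of constant length vectors is preserved by differentiation. -/
theorem lor_partials_eq_zero {c : ℝ} (hX : DifferentiableAt ℝ X u)
    (h : ∀ᶠ y in nhds u, lor (X y) (X y) = c) (i : Fin 2) : lor (X u) (partials X u i) = 0 := by
  have h1 := pd_congr i h
  rw [pd_lor hX hX, lor_comm (partials X u i)] at h1
  have : pd i (fun _ : E2 => c) u = 0 := by simp [pd]
  rw [this] at h1
  linarith

theorem lor_partials_add {c : ℝ} (hX : DifferentiableAt ℝ X u) (hY : DifferentiableAt ℝ Y u)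
    (h : ∀ᶠ y in nhds u, lor (X y) (Y y) = c) (i : Fin 2) :
    lor (partials X u i) (Y u) + lor (X u) (partials Y u i) = 0 := by
  have h1 := pd_congr i h
  rw [pd_lor hX hY] at h1
  rw [h1]
  simp [pd]

end Calculus

/-- The continuous unit normal of a surface of class `C^4` is of class `C^3`. -/
theorem contDiffAt_normal {x n : E2 → Mink} {u : E2} (hx : ContDiffAt ℝ 4 x u)
    (hn : ContinuousAt n u) (hJ : ∀ᶠ y in nhds u, TangentJet (x y) (n y) (partials x y)) :
    ContDiffAt ℝ 3 n u := by
  have hp : ∀ i, ContDiffAt ℝ 3 (fun y => partials x y i) u := fun i =>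
    contDiffAt_partials hx (by norm_num) i
  have hx3 : ContDiffAt ℝ 3 x u := hx.of_le (by norm_num)
  set w : E2 → ℝ := fun y => vol (x y) (n y) (partials x y 0) (partials x y 1) with hw
  have hwc : ContinuousAt w u := by
    have hX' := continuousAt_pi.1 hx.continuousAt
    have hY' := continuousAt_pi.1 hn
    have hZ' := continuousAt_pi.1 (hp 0).continuousAt
    have hW' := continuousAt_pi.1 (hp 1).continuousAt
    simp only [hw, vol_eq]
    fun_prop
  have hJu := hJ.self_of_nhds
  have hg : ContDiffAt ℝ 3 (fun y => √(gramDet (partials x y))) u :=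
    (((contDiffAt_lor (hp 0) (hp 0)).mul (contDiffAt_lor (hp 1) (hp 1))).sub
      ((contDiffAt_lor (hp 0) (hp 1)).pow 2)).sqrt hJu.gramDet_pos.ne'
  have hwd : ContDiffAt ℝ 3 w u := by
    -- Here continuity of the normal enters: `w` is `±√gramDet` pointwise, and continuity makes the
    -- sign locally constant.
    rcases lt_or_gt_of_ne (show w u ≠ 0 from hJu.vol_ne) with h | h
    · refine hg.neg.congr_of_eventuallyEq ?_
      filter_upwards [hJ, hwc.eventually (gt_mem_nhds h)] with y hy hwy
      rw [← hy.vol_sq, Real.sqrt_sq_eq_abs, abs_of_neg hwy, neg_neg]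
    · refine hg.congr_of_eventuallyEq ?_
      filter_upwards [hJ, hwc.eventually (lt_mem_nhds h)] with y hy hwy
      rw [← hy.vol_sq, Real.sqrt_sq_eq_abs, abs_of_pos hwy]
  refine ((hwd.inv hJu.vol_ne).smul (contDiffAt_cross3 hx3 (hp 0) (hp 1))).congr_of_eventuallyEq ?_
  filter_upwards [hJ] with y hy
  rw [Pi.smul_apply', Pi.inv_apply, hy.cross3_eq, smul_smul, inv_mul_cancel₀ hy.vol_ne, one_smul]

/-- Differentiating the relations `⟨x, n⟩ = 0` and `⟨n, n⟩ = 1` makes `dn` tangent. Differentiating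
`⟨n, ∂_i x⟩ = 0`, with equality of mixed partials, makes the second form symmetric. -/
theorem surfaceJet_of_tangentJet {x n : E2 → Mink} {u : E2} (hx : ContDiffAt ℝ 2 x u)
    (hn : DifferentiableAt ℝ n u)
    (hJ : ∀ᶠ y in nhds u, TangentJet (x y) (n y) (partials x y)) :
    SurfaceJet (x u) (n u) (partials x u) (partials n u) := by
  have hx1 : DifferentiableAt ℝ x u := hx.differentiableAt (by norm_num)
  have hp : ∀ i, DifferentiableAt ℝ (fun y => partials x y i) u := fun i =>
    (contDiffAt_partials hx (m := 1) (by norm_num) i).differentiableAt (by norm_num)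
  refine { hJ.self_of_nhds with x_dn := ?_, n_dn := ?_, second_symm := ?_ }
  · intro i
    have h := lor_partials_add hx1 hn (hJ.mono fun y hy => hy.xn) i
    rw [lor_comm (partials x u i), hJ.self_of_nhds.n_dx] at h
    linarith
  · exact lor_partials_eq_zero hn (hJ.mono fun y hy => hy.nn)
  · have h1 := lor_partials_add hn (hp 1) (hJ.mono fun y hy => hy.n_dx 1) 0
    have h2 := lor_partials_add hn (hp 0) (hJ.mono fun y hy => hy.n_dx 0) 1
    rw [partials_partials_comm hx] at h1
    linarith

/-- The Codazzi equation in a principal orthonormal frame `X, Y` with coframe `θ, η` and principal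
curvatures `a, b`. -/
theorem codazzi_coframe {x n X Y : E2 → Mink} {θ η : Fin 2 → E2 → ℝ} {a b : E2 → ℝ} {u : E2}
    (hx : ContDiffAt ℝ 2 x u) (hn : ContDiffAt ℝ 2 n u) (hX : DifferentiableAt ℝ X u)
    (hθ : ∀ i, DifferentiableAt ℝ (θ i) u) (ha : DifferentiableAt ℝ a u)
    (hXX : ∀ᶠ y in nhds u, lor (X y) (X y) = 1) (hXY : ∀ᶠ y in nhds u, lor (X y) (Y y) = 0)
    (hdx : ∀ᶠ y in nhds u, ∀ i, partials x y i = θ i y • X y + η i y • Y y)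
    (hdn : ∀ᶠ y in nhds u, ∀ i, partials n y i = (a y * θ i y) • X y + (b y * η i y) • Y y) :
    (b u - a u) * (pd 0 (θ 1) u - pd 1 (θ 0) u) = pd 0 a u * θ 1 u - pd 1 a u * θ 0 u := by
  have hpx : ∀ i, DifferentiableAt ℝ (fun y => partials x y i) u := fun i =>
    (contDiffAt_partials hx (m := 1) (by norm_num) i).differentiableAt (by norm_num)
  have hpn : ∀ i, DifferentiableAt ℝ (fun y => partials n y i) u := fun i =>
    (contDiffAt_partials hn (m := 1) (by norm_num) i).differentiableAt (by norm_num)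
  have hX0 := lor_partials_eq_zero hX hXX
  -- The derivative of `θ i = ⟨∂_i x, X⟩`. Because `X` has unit length, the derivative of `X`
  -- contributes only through the connection form `⟨Y, ∂_j X⟩`.
  have h1 : ∀ i j, pd j (θ i) u = lor (partials (fun y => partials x y i) u j) (X u)
      + η i u * lor (Y u) (partials X u j) := by
    intro i j
    have e : (fun y => lor (partials x y i) (X y)) =ᶠ[nhds u] θ i := by
      filter_upwards [hdx, hXX, hXY] with y h1 h2 h3
      rw [h1, lor_add_left, lor_smul_left, lor_smul_left, h2, lor_comm, h3]
      ring
    have h2 := pd_congr j e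
    rw [pd_lor (hpx i) hX, hdx.self_of_nhds, lor_add_left, lor_smul_left, lor_smul_left, hX0] at h2
    linarith
  have h2 : ∀ i j, pd j a u * θ i u + a u * pd j (θ i) u
      = lor (partials (fun y => partials n y i) u j) (X u)
      + b u * η i u * lor (Y u) (partials X u j) := by
    intro i j
    have e : (fun y => lor (partials n y i) (X y)) =ᶠ[nhds u] fun y => a y * θ i y := by
      filter_upwards [hdn, hXX, hXY] with y h1 h2 h3
      rw [h1, lor_add_left, lor_smul_left, lor_smul_left, h2, lor_comm, h3]
      ring
    have h2 := pd_congr j e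
    rw [pd_lor (hpn i) hX, hdn.self_of_nhds, lor_add_left, lor_smul_left, lor_smul_left, hX0,
      pd_mul _ ha (hθ i)] at h2
    linarith
  have a1 := h1 0 1
  have b1 := h2 0 1
  rw [partials_partials_comm hx] at a1
  rw [partials_partials_comm hn] at b1
  -- Antisymmetrizing removes the second partials of `x` and `n`. Eliminating the connection form
  -- leaves `b dθ = d(a θ)`.
  linear_combination b u * (h1 1 0 - a1) - (h2 1 0 - b1)

/-! ### Smooth principal frames and the curvature of the induced plane metric -/

section Principal

variable {x n : E2 → Mink} {u : E2}

/-- The curvatures are algebraic in the first partials of `x` and `n`, which costs one derivative.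
The square root is smooth only where the discriminant is nonzero. -/
theorem contDiffAt_curv (hx : ContDiffAt ℝ 3 x u) (hn : ContDiffAt ℝ 3 n u)
    (hJ : SurfaceJet (x u) (n u) (partials x u) (partials n u))
    (hd : curvDisc (partials x u) (partials n u) ≠ 0) :
    ContDiffAt ℝ 2 (fun y => curvDisc (partials x y) (partials n y)) u ∧
    ContDiffAt ℝ 2 (fun y => curvMax (partials x y) (partials n y)) u ∧
    ContDiffAt ℝ 2 (fun y => curvMin (partials x y) (partials n y)) u := by
  have hp : ∀ i, ContDiffAt ℝ 2 (fun y => partials x y i) u := fun i =>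
    contDiffAt_partials hx (by norm_num) i
  have hq : ∀ i, ContDiffAt ℝ 2 (fun y => partials n y i) u := fun i =>
    contDiffAt_partials hn (by norm_num) i
  have g := fun i j => contDiffAt_lor (hp i) (hp j)
  have h := fun i j => contDiffAt_lor (hq i) (hp j)
  have hD : ContDiffAt ℝ 2 (fun y => gramDet (partials x y)) u :=
    ((g 0 0).mul (g 1 1)).sub ((g 0 1).pow 2)
  have hS : ContDiffAt ℝ 2 (fun y => curvSum (partials x y) (partials n y)) u :=
    ((((g 0 0).mul (h 1 1)).sub ((contDiffAt_const.mul (g 0 1)).mul (h 0 1))).add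
      ((g 1 1).mul (h 0 0))).div hD hJ.gramDet_pos.ne'
  have hP : ContDiffAt ℝ 2 (fun y => curvProd (partials x y) (partials n y)) u :=
    (((h 0 0).mul (h 1 1)).sub ((h 0 1).pow 2)).div hD hJ.gramDet_pos.ne'
  have hdisc : ContDiffAt ℝ 2 (fun y => curvDisc (partials x y) (partials n y)) u :=
    (hS.pow 2).sub (contDiffAt_const.mul hP)
  exact ⟨hdisc, (hS.add (hdisc.sqrt hd)).div_const 2, (hS.sub (hdisc.sqrt hd)).div_const 2⟩

theorem exists_unit_principal_of_principal {v : Fin 2 → E2 → ℝ}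
    (hx : ContDiffAt ℝ 3 x u) (hv : ∀ i, ContDiffAt ℝ 2 (v i) u)
    (hJ : ∀ᶠ y in nhds u, SurfaceJet (x y) (n y) (partials x y) (partials n y))
    (hv0 : (fun i => v i u) ≠ 0)
    (h : ∀ᶠ y in nhds u, ∀ j, v 0 y * lor (partials n y 0) (partials x y j)
      + v 1 y * lor (partials n y 1) (partials x y j)
      = curvMax (partials x y) (partials n y) * (v 0 y * lor (partials x y 0) (partials x y j)
        + v 1 y * lor (partials x y 1) (partials x y j))) :
    ∃ e : Fin 2 → E2 → ℝ, (∀ i, ContDiffAt ℝ 2 (e i) u) ∧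
      (∀ᶠ y in nhds u, ∀ j, e 0 y * lor (partials n y 0) (partials x y j)
      + e 1 y * lor (partials n y 1) (partials x y j)
      = curvMax (partials x y) (partials n y) * (e 0 y * lor (partials x y 0) (partials x y j)
        + e 1 y * lor (partials x y 1) (partials x y j))) ∧
      ∀ᶠ y in nhds u, lor (e 0 y • partials x y 0 + e 1 y • partials x y 1)
        (e 0 y • partials x y 0 + e 1 y • partials x y 1) = 1 := by
  have hp : ∀ i, ContDiffAt ℝ 2 (fun y => partials x y i) u := fun i =>
    contDiffAt_partials hx (by norm_num) i
  have hV : ContDiffAt ℝ 2 (fun y => v 0 y • partials x y 0 + v 1 y • partials x y 1) u :=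
    ((hv 0).smul (hp 0)).add ((hv 1).smul (hp 1))
  set q : E2 → ℝ := fun y => lor (v 0 y • partials x y 0 + v 1 y • partials x y 1)
    (v 0 y • partials x y 0 + v 1 y • partials x y 1) with hq
  have hqd : ContDiffAt ℝ 2 q u := contDiffAt_lor hV hV
  have hq0 : 0 < q u := by
    have := hJ.self_of_nhds.gram_pos hv0
    simp only [hq]
    rw [lor_comb_comb, lor_comm (partials x u 1) (partials x u 0)]
    linarith
  refine ⟨fun i y => v i y / √(q y), fun i => (hv i).div (hqd.sqrt hq0.ne')
    (Real.sqrt_pos.2 hq0).ne', ?_, ?_⟩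
  · filter_upwards [h] with y hy j
    linear_combination (1 / √(q y)) * hy j
  · filter_upwards [hqd.continuousAt.eventually (lt_mem_nhds hq0)] with y hy
    have e1 : (v 0 y / √(q y)) • partials x y 0 + (v 1 y / √(q y)) • partials x y 1
        = (√(q y))⁻¹ • (v 0 y • partials x y 0 + v 1 y • partials x y 1) := by
      rw [smul_add, smul_smul, smul_smul]
      simp only [div_eq_inv_mul]
    rw [e1, lor_smul_left, lor_smul_right]
    change (√(q y))⁻¹ * ((√(q y))⁻¹ * q y) = 1
    have h2 := Real.sqrt_pos.2 hy
    field_simp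
    rw [Real.sq_sqrt hy.le]

theorem exists_unit_principal (hx : ContDiffAt ℝ 3 x u) (hn : ContDiffAt ℝ 3 n u)
    (hJ : ∀ᶠ y in nhds u, SurfaceJet (x y) (n y) (partials x y) (partials n y))
    (hd : curvDisc (partials x u) (partials n u) ≠ 0) :
    ∃ e : Fin 2 → E2 → ℝ, (∀ i, ContDiffAt ℝ 2 (e i) u) ∧
      (∀ᶠ y in nhds u, ∀ j, e 0 y * lor (partials n y 0) (partials x y j)
      + e 1 y * lor (partials n y 1) (partials x y j)
      = curvMax (partials x y) (partials n y) * (e 0 y * lor (partials x y 0) (partials x y j)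
        + e 1 y * lor (partials x y 1) (partials x y j))) ∧
      ∀ᶠ y in nhds u, lor (e 0 y • partials x y 0 + e 1 y • partials x y 1)
        (e 0 y • partials x y 0 + e 1 y • partials x y 1) = 1 := by
  obtain ⟨-, ck, -⟩ := contDiffAt_curv hx hn hJ.self_of_nhds hd
  have hp : ∀ i, ContDiffAt ℝ 2 (fun y => partials x y i) u := fun i =>
    contDiffAt_partials hx (by norm_num) i
  have hq : ∀ i, ContDiffAt ℝ 2 (fun y => partials n y i) u := fun i =>
    contDiffAt_partials hn (by norm_num) i
  -- The second form minus `curvMax` times the first: a singular symmetric matrix. A nonzero column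
  -- of its adjugate is an eigenvector depending on the point as smoothly as the entries.
  set m : Fin 2 → Fin 2 → E2 → ℝ := fun i j y => lor (partials n y i) (partials x y j)
    - curvMax (partials x y) (partials n y) * lor (partials x y i) (partials x y j) with hm
  have cm : ∀ i j, ContDiffAt ℝ 2 (m i j) u := fun i j =>
    (contDiffAt_lor (hq i) (hp j)).sub (ck.mul (contDiffAt_lor (hp i) (hp j)))
  have hdet : ∀ᶠ y in nhds u, m 0 0 y * m 1 1 y = m 0 1 y ^ 2 ∧ m 1 0 y = m 0 1 y := by
    filter_upwards [hJ] with y hy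
    refine ⟨?_, ?_⟩
    · have h := hy.four_mul_det_pencil (curvMax (partials x y) (partials n y))
      have h2 : 2 * curvMax (partials x y) (partials n y) - curvSum (partials x y) (partials n y)
          = √(curvDisc (partials x y) (partials n y)) := by
        rw [curvMax]
        ring
      rw [h2, Real.sq_sqrt hy.curvDisc_nonneg] at h
      simp only [hm]
      linarith
    · simp only [hm]
      rw [lor_comm (partials x y 1) (partials x y 0), hy.second_symm]
  by_cases h1 : m 0 1 u = 0 ∧ m 1 1 u = 0
  -- If all entries of `m` vanished, the point would be umbilic; so one of the two adjugate columns
  -- is nonzero at `u`, and this decides the case.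
  · have h0 : m 0 0 u ≠ 0 := by
      intro h0
      apply hd
      have hD := hJ.self_of_nhds.gramDet_pos
      obtain ⟨h1, h2⟩ := h1
      simp only [hm, sub_eq_zero] at h0 h1 h2
      generalize curvMax (partials x u) (partials n u) = k at h0 h1 h2
      simp only [curvDisc, curvSum, curvProd]
      field_simp
      rw [h0, h1, h2]
      simp only [gramDet]
      ring
    refine exists_unit_principal_of_principal (v := ![fun y => -m 0 1 y, m 0 0]) hx ?_ hJ ?_ ?_
    · intro i
      fin_cases i
      · exact (cm 0 1).neg
      · exact cm 0 0
    · intro h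
      exact h0 (by simpa using congrFun h 1)
    · filter_upwards [hdet] with y hy j
      simp only [Matrix.cons_val_zero, Matrix.cons_val_one]
      have e : -m 0 1 y * m 0 j y + m 0 0 y * m 1 j y = 0 := by
        fin_cases j <;> simp only [Fin.zero_eta, Fin.mk_one]
        · linear_combination m 0 0 y * hy.2
        · linear_combination hy.1
      simp only [hm] at e ⊢
      linear_combination e
  · refine exists_unit_principal_of_principal (v := ![m 1 1, fun y => -m 0 1 y]) hx ?_ hJ ?_ ?_
    · intro i
      fin_cases i
      · exact cm 1 1
      · exact (cm 0 1).neg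
    · intro h
      exact h1 ⟨by simpa using congrFun h 1, by simpa using congrFun h 0⟩
    · filter_upwards [hdet] with y hy j
      simp only [Matrix.cons_val_zero, Matrix.cons_val_one]
      have e : m 1 1 y * m 0 j y + -m 0 1 y * m 1 j y = 0 := by
        fin_cases j <;> simp only [Fin.zero_eta, Fin.mk_one]
        · linear_combination hy.1 - m 0 1 y * hy.2
        · ring
      simp only [hm] at e ⊢
      linear_combination e

/-- The plane metric that the neutral metric induces on a surface without umbilics is flat at
exactly the points where the differentials of the principal curvatures are dependent. -/
theorem planeGaussCurvature_normal_eq_zero_iff (hx : ContDiffAt ℝ 3 x u) (hn : ContDiffAt ℝ 3 n u)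
    (hJ : ∀ᶠ y in nhds u, SurfaceJet (x y) (n y) (partials x y) (partials n y))
    (hd : curvDisc (partials x u) (partials n u) ≠ 0) {g : E2 → Matrix (Fin 2) (Fin 2) ℝ}
    (hg : ∀ᶠ y in nhds u, ∀ i j, g y i j = (vol (x y) (n y) (partials x y i) (partials n y j)
      + vol (x y) (n y) (partials x y j) (partials n y i)) / 2) :
    planeGaussCurvature g u = 0 ↔
      pd 0 (fun y => curvMax (partials x y) (partials n y)) u
          * pd 1 (fun y => curvMin (partials x y) (partials n y)) u
        - pd 1 (fun y => curvMax (partials x y) (partials n y)) u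
          * pd 0 (fun y => curvMin (partials x y) (partials n y)) u = 0 := by
  obtain ⟨e, ce, he, hunit⟩ := exists_unit_principal hx hn hJ hd
  obtain ⟨cd, ca, cb⟩ := contDiffAt_curv hx hn hJ.self_of_nhds hd
  have hp : ∀ i, ContDiffAt ℝ 2 (fun y => partials x y i) u := fun i =>
    contDiffAt_partials hx (by norm_num) i
  have hJu := hJ.self_of_nhds
  set X : E2 → Mink := fun y => e 0 y • partials x y 0 + e 1 y • partials x y 1 with hX
  set Y : E2 → Mink := fun y => (vol (x y) (n y) (partials x y 0) (partials x y 1))⁻¹ •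
    (lor (partials x y 0) (X y) • partials x y 1 - lor (partials x y 1) (X y) • partials x y 0)
    with hY
  set a : E2 → ℝ := fun y => curvMax (partials x y) (partials n y) with ha
  set b : E2 → ℝ := fun y => curvMin (partials x y) (partials n y) with hb
  have cX : ContDiffAt ℝ 2 X u := ((ce 0).smul (hp 0)).add ((ce 1).smul (hp 1))
  have cY : ContDiffAt ℝ 2 Y u :=
    ((contDiffAt_vol (hx.of_le (by norm_num)) (hn.of_le (by norm_num)) (hp 0) (hp 1)).inv
      hJu.vol_ne).smul (((contDiffAt_lor (hp 0) cX).smul (hp 1)).sub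
        ((contDiffAt_lor (hp 1) cX).smul (hp 0)))
  set θ : Fin 2 → E2 → ℝ := fun i y => lor (partials x y i) (X y) with hθ
  set η : Fin 2 → E2 → ℝ := fun i y => lor (partials x y i) (Y y) with hη
  have cθ : ∀ i, ContDiffAt ℝ 2 (θ i) u := fun i => contDiffAt_lor (hp i) cX
  have cη : ∀ i, ContDiffAt ℝ 2 (η i) u := fun i => contDiffAt_lor (hp i) cY
  have hfr : ∀ᶠ y in nhds u, lor (Y y) (Y y) = 1 ∧ lor (X y) (Y y) = 0 ∧
      vol (x y) (n y) (X y) (Y y) = 1 ∧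
      (∀ i, partials x y i = θ i y • X y + η i y • Y y) ∧
      ∀ i, partials n y i = (a y * θ i y) • X y + (b y * η i y) • Y y := by
    filter_upwards [hJ, he, hunit] with y h1 h2 h3
    exact h1.principal_frame (e := fun i => e i y) h2 rfl h3 rfl
  have ev : ∀ {V : Type} [NormedAddCommGroup V] [NormedSpace ℝ V] {F : E2 → V},
      ContDiffAt ℝ 2 F u → ∀ᶠ y in nhds u, ContDiffAt ℝ 2 F y :=
    fun hF => hF.eventually (by simp)
  have ex : ∀ᶠ y in nhds u, ContDiffAt ℝ 2 x y := ev (hx.of_le (by norm_num))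
  have en : ∀ᶠ y in nhds u, ContDiffAt ℝ 2 n y := ev (hn.of_le (by norm_num))
  have hdiff : ∀ {V : Type} [NormedAddCommGroup V] [NormedSpace ℝ V] {F : E2 → V} {y : E2},
      ContDiffAt ℝ 2 F y → DifferentiableAt ℝ F y := fun h => h.differentiableAt (by norm_num)
  refine planeGaussCurvature_eq_zero_iff (θ := θ) (η := η) (Filter.eventually_all.2 fun i => ev (cθ i))
    (Filter.eventually_all.2 fun i => ev (cη i)) (ev ca) (ev cb) ?_ ?_ ?_ ?_ ?_
  · filter_upwards [hJ, cd.continuousAt.eventually_ne hd] with y h1 h2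
    have h3 : b y - a y = -√(curvDisc (partials x y) (partials n y)) := by
      simp only [ha, hb, curvMax, curvMin]
      ring
    rw [h3]
    exact neg_ne_zero.2 (Real.sqrt_ne_zero'.2 (lt_of_le_of_ne h1.curvDisc_nonneg h2.symm))
  · filter_upwards [hJ, hfr] with y h1 h2 h3
    apply h1.vol_ne
    rw [h2.2.2.2.1 0, h2.2.2.2.1 1, vol_comb_comb, mul_comm (η 0 y), h3, zero_mul]
  · filter_upwards [hg, hfr] with y h1 h2 i j
    rw [h1, h2.2.2.2.1 i, h2.2.2.2.1 j, h2.2.2.2.2 i, h2.2.2.2.2 j, vol_comb_comb, vol_comb_comb,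
      h2.2.2.1]
    ring
  · filter_upwards [hfr.eventually_nhds, hunit.eventually_nhds, ex, en, ev cX,
      Filter.eventually_all.2 fun i => ev (cθ i), ev ca] with y h1 h2 h3 h4 h5 h6 h7
    exact codazzi_coframe h3 h4 (hdiff h5) (fun i => hdiff (h6 i)) (hdiff h7) h2
      (h1.mono fun z hz => hz.2.1) (h1.mono fun z hz => hz.2.2.2.1)
      (h1.mono fun z hz => hz.2.2.2.2)
  · filter_upwards [hfr.eventually_nhds, ex, en, ev cY,
      Filter.eventually_all.2 fun i => ev (cη i), ev cb] with y h1 h3 h4 h5 h6 h7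
    -- The same Codazzi equation with the two principal directions exchanged. The exchange turns `b
    -- - a` into `a - b`, whence the sign in `hdη`.
    have := codazzi_coframe (X := Y) (Y := X) (θ := η) (η := θ) (a := b) (b := a) h3 h4 (hdiff h5)
      (fun i => hdiff (h6 i)) (hdiff h7) (h1.mono fun z hz => hz.1)
      (h1.mono fun z hz => by rw [lor_comm]; exact hz.2.1)
      (h1.mono fun z hz i => by rw [hz.2.2.2.1 i, add_comm])
      (h1.mono fun z hz i => by rw [hz.2.2.2.2 i, add_comm])
    linear_combination -this

end Principal

/-! ### The metric induced on the surface of normal geodesics -/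

/-- The derivative of `ideal` at `p` in the direction `v`. -/
def idealDeriv (p v : Mink) : R3 :=
  ![(v 1 * p 0 - p 1 * v 0) / p 0 ^ 2, (v 2 * p 0 - p 2 * v 0) / p 0 ^ 2,
    (v 3 * p 0 - p 3 * v 0) / p 0 ^ 2]

theorem hasFDerivAt_ideal {p : E2 → Mink} {u : E2} (hp : DifferentiableAt ℝ p u)
    (h0 : p u 0 ≠ 0) :
    DifferentiableAt ℝ (fun y => ideal (p y)) u ∧
      ∀ v, fderiv ℝ (fun y => ideal (p y)) u v = idealDeriv (p u) (fderiv ℝ p u v) := by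
  have hc := differentiableAt_pi.1 hp
  have hq : ∀ a, HasFDerivAt (fun y => p y a / p y 0) (p u a • (-(p u 0 ^ 2)⁻¹ •
      fderiv ℝ (fun y => p y 0) u) + (p u 0)⁻¹ • fderiv ℝ (fun y => p y a) u) u := fun a => by
    simp only [div_eq_mul_inv]
    exact (hc a).hasFDerivAt.fun_mul ((hasDerivAt_inv h0).comp_hasFDerivAt u (hc 0).hasFDerivAt)
  have hv : ∀ a v, fderiv ℝ (fun y => p y a) u v = fderiv ℝ p u v a := by
    intro a v
    rw [fderiv_pi hc]
    rfl
  have hd : DifferentiableAt ℝ (fun y => ideal (p y)) u := by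
    rw [differentiableAt_pi]
    intro a
    fin_cases a
    · exact (hq 1).differentiableAt
    · exact (hq 2).differentiableAt
    · exact (hq 3).differentiableAt
  refine ⟨hd, fun v => ?_⟩
  rw [fderiv_pi (differentiableAt_pi.1 hd)]
  funext a
  rw [ContinuousLinearMap.pi_apply]
  have hq' : ∀ a, fderiv ℝ (fun y => p y a / p y 0) u v
      = (fderiv ℝ p u v a * p u 0 - p u a * fderiv ℝ p u v 0) / p u 0 ^ 2 := by
    intro a
    rw [(hq a).fderiv]
    simp only [smul_apply, add_apply, smul_eq_mul, hv]
    field_simp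
    ring
  fin_cases a
  · exact hq' 1
  · exact hq' 2
  · exact hq' 3

/-- Subtracting `(v 0 / p 0) • p` from `v` leaves `p 0` times `idealDeriv p v` with zero time part,
and similarly for `w` and `q`. With `p`, `q` scaled to time coordinate `1`, the four-dimensional
determinant reduces to the three-dimensional one. -/
theorem cross_idealDeriv {p q : Mink} (hp : p 0 ≠ 0) (hq : q 0 ≠ 0) (v w : Mink) :
    (ideal q - ideal p) ⬝ᵥ (idealDeriv p v ⨯₃ idealDeriv q w)
      = vol p q v w / (p 0 * q 0) ^ 2 := by
  simp [ideal, idealDeriv, cross_apply, dotProduct, Fin.sum_univ_three, vol_eq]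
  field_simp
  ring

theorem one_sub_dot_ideal {p q : Mink} (hp : p 0 ≠ 0) (hq : q 0 ≠ 0) :
    1 - ideal p ⬝ᵥ ideal q = -lor p q / (p 0 * q 0) := by
  simp [ideal, dotProduct, Fin.sum_univ_three, lor]
  field_simp
  ring

/-- The time coordinates cancel between numerator and denominator, and `lor (x - n) (x + n) = -2`.
Symmetrizing then kills the terms `vol x n v w` and `vol x n v' w'`, which are antisymmetric. -/
theorem neutralMetric_normal {x n : Mink} (hx : x ∈ hyp3) (hxn : lor x n = 0) (hn : lor n n = 1)
    (v v' w w' : Mink) :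
    neutralMetric (geodBegin x n, geodEnd x n)
      (idealDeriv (x - n) (v - v'), idealDeriv (x + n) (v + v'))
      (idealDeriv (x - n) (w - w'), idealDeriv (x + n) (w + w'))
      = (vol x n v w' + vol x n w v') / 2 := by
  obtain ⟨h1, h2⟩ := geod_aux hx hxn hn
  have hp : (x - n) 0 ≠ 0 := h1.ne'
  have hq : (x + n) 0 ≠ 0 := h2.ne'
  have hl : lor (x - n) (x + n) = -2 := by
    rw [lor_add_right, lor_sub_left, lor_sub_left, hx.1, hn, hxn, lor_comm n x, hxn]
    ring
  simp only [neutralMetric, geodBegin, geodEnd]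
  rw [cross_idealDeriv hp hq, cross_idealDeriv hp hq, one_sub_dot_ideal hp hq, hl]
  have e : vol (x - n) (x + n) (v - v') (w + w') + vol (x - n) (x + n) (w - w') (v + v')
      = 4 * (vol x n v w' + vol x n w v') := by
    simp only [vol_eq, Pi.add_apply, Pi.sub_apply]
    ring
  field_simp
  rw [e]
  ring

/-! ### From coordinate charts to the manifold -/

section Chart

variable {M : Type*} [TopologicalSpace M] [ChartedSpace E2 M]

/-- Near the point `F` is its coordinate expression composed with the chart, so differentiability
transfers, and the chain rule gives the derivative. -/
theorem mfderiv_of_chart [IsManifold 𝓘(ℝ, E2) 1 M] {V : Type*} [NormedAddCommGroup V]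
    [NormedSpace ℝ V] {F : M → V} {m : M} {u : E2} (hu : u ∈ (chartAt E2 m).target)
    (hF : DifferentiableAt ℝ (fun y => F ((chartAt E2 m).symm y)) u) :
    MDifferentiableAt 𝓘(ℝ, E2) 𝓘(ℝ, V) F ((chartAt E2 m).symm u) ∧
      ∀ v : E2, mfderiv 𝓘(ℝ, E2) 𝓘(ℝ, V) F ((chartAt E2 m).symm u)
        (mfderiv 𝓘(ℝ, E2) 𝓘(ℝ, E2) (chartAt E2 m).symm u v)
        = fderiv ℝ (fun y => F ((chartAt E2 m).symm y)) u v := by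
  have hc := mdifferentiable_chart (I := 𝓘(ℝ, E2)) m
  have hs := hc.symm.mdifferentiableAt hu
  have hmem := (chartAt E2 m).map_target hu
  have hFm : MDifferentiableAt 𝓘(ℝ, E2) 𝓘(ℝ, V) F ((chartAt E2 m).symm u) := by
    have h1 : MDifferentiableAt 𝓘(ℝ, E2) 𝓘(ℝ, V) (fun y => F ((chartAt E2 m).symm y))
        (chartAt E2 m ((chartAt E2 m).symm u)) := by
      rw [(chartAt E2 m).right_inv hu]
      exact hF.mdifferentiableAt
    refine (h1.comp _ (hc.mdifferentiableAt hmem)).congr_of_eventuallyEq ?_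
    filter_upwards [(chartAt E2 m).open_source.mem_nhds hmem] with p hp
    simp [(chartAt E2 m).left_inv hp]
  refine ⟨hFm, fun v => ?_⟩
  have h2 := mfderiv_comp u hFm hs
  rw [← mfderiv_eq_fderiv]
  change _ = mfderiv 𝓘(ℝ, E2) 𝓘(ℝ, V) (F ∘ (chartAt E2 m).symm) u v
  rw [h2]
  rfl

theorem mfderiv_chart_symm_bijective [IsManifold 𝓘(ℝ, E2) 1 M] {m : M} {u : E2}
    (hu : u ∈ (chartAt E2 m).target) :
    Function.Bijective (mfderiv 𝓘(ℝ, E2) 𝓘(ℝ, E2) (chartAt E2 m).symm u) :=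
  (mdifferentiable_chart (I := 𝓘(ℝ, E2)) m).symm.mfderiv_bijective hu

theorem mfderiv_chart_symm_surjective [IsManifold 𝓘(ℝ, E2) 1 M] {m : M} {u : E2}
    (hu : u ∈ (chartAt E2 m).target)
    (v : TangentSpace 𝓘(ℝ, E2) ((chartAt E2 m).symm u)) :
    ∃ w : E2, mfderiv 𝓘(ℝ, E2) 𝓘(ℝ, E2) (chartAt E2 m).symm u w = v :=
  (mfderiv_chart_symm_bijective hu).2 v

theorem eq_sum_cvec (v : E2) : v = v 0 • cvec 0 + v 1 • cvec 1 := by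
  ext i
  fin_cases i <;> simp [cvec]

theorem fderiv_eq_partials (X : E2 → Mink) (u v : E2) :
    fderiv ℝ X u v = v 0 • partials X u 0 + v 1 • partials X u 1 := by
  conv_lhs => rw [eq_sum_cvec v]
  rw [map_add, map_smul, map_smul]
  rfl

theorem fderiv_eq_pd (F : E2 → ℝ) (u v : E2) :
    fderiv ℝ F u v = v 0 * pd 0 F u + v 1 * pd 1 F u := by
  conv_lhs => rw [eq_sum_cvec v]
  rw [map_add, map_smul, map_smul]
  rfl

variable {φ N : M → Mink}

namespace IsOrientedImmersion

variable [IsManifold 𝓘(ℝ, E2) 4 M] {m : M} {u : E2}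

theorem contDiffAt_position (hφ : IsOrientedImmersion φ N) (hu : u ∈ (chartAt E2 m).target) :
    ContDiffAt ℝ 4 (fun y => φ ((chartAt E2 m).symm y)) u := by
  have h := hφ.contMDiff.comp_contMDiffOn (contMDiffOn_chart_symm (I := 𝓘(ℝ, E2)) (x := m) (n := 4))
  exact (contMDiffOn_iff_contDiffOn.1 h).contDiffAt ((chartAt E2 m).open_target.mem_nhds hu)

theorem tangentJet (hφ : IsOrientedImmersion φ N) (hu : u ∈ (chartAt E2 m).target) :
    TangentJet (φ ((chartAt E2 m).symm u)) (N ((chartAt E2 m).symm u))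
      (partials (fun y => φ ((chartAt E2 m).symm y)) u) := by
  have : IsManifold 𝓘(ℝ, E2) 1 M := IsManifold.of_le (n := 4) (by norm_num)
  have hd := (hφ.contDiffAt_position hu).differentiableAt (by norm_num)
  obtain ⟨-, hf⟩ := mfderiv_of_chart hu hd
  refine ⟨(hφ.mem_hyp3 _).1, hφ.normal_tangent_hyp3 _, hφ.normal_unit _, ?_, ?_, ?_⟩
  · exact lor_partials_eq_zero hd (Filter.Eventually.of_forall fun y => (hφ.mem_hyp3 _).1)
  · intro i
    rw [partials, ← hf]
    exact hφ.normal_orthogonal _ _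
  · intro c hc
    set w : E2 := c 0 • cvec 0 + c 1 • cvec 1 with hw
    have h0 : fderiv ℝ (fun y => φ ((chartAt E2 m).symm y)) u w = 0 := by
      rw [hw, map_add, map_smul, map_smul]
      exact hc
    rw [← hf] at h0
    have h1 := hφ.immersion _ (h0.trans (map_zero _).symm)
    have h2 := (mfderiv_chart_symm_bijective hu).1 (h1.trans (map_zero _).symm)
    have h3 : w = 0 := h2
    funext i
    have h4 := congrArg (fun z : E2 => z i) h3
    fin_cases i <;> simpa [hw, cvec] using h4

theorem contDiffAt_normal (hφ : IsOrientedImmersion φ N) (hu : u ∈ (chartAt E2 m).target) :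
    ContDiffAt ℝ 3 (fun y => N ((chartAt E2 m).symm y)) u := by
  refine HypSurface.contDiffAt_normal (hφ.contDiffAt_position hu) ?_ ?_
  · exact hφ.normal_continuous.continuousAt.comp ((chartAt E2 m).symm.continuousAt hu)
  · filter_upwards [(chartAt E2 m).open_target.mem_nhds hu] with y hy
    exact hφ.tangentJet hy

theorem surfaceJet (hφ : IsOrientedImmersion φ N) (hu : u ∈ (chartAt E2 m).target) :
    SurfaceJet (φ ((chartAt E2 m).symm u)) (N ((chartAt E2 m).symm u))
      (partials (fun y => φ ((chartAt E2 m).symm y)) u)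
      (partials (fun y => N ((chartAt E2 m).symm y)) u) := by
  refine surfaceJet_of_tangentJet (x := fun y => φ ((chartAt E2 m).symm y))
    (n := fun y => N ((chartAt E2 m).symm y)) ((hφ.contDiffAt_position hu).of_le (by norm_num))
    ((hφ.contDiffAt_normal hu).differentiableAt (by norm_num)) ?_
  filter_upwards [(chartAt E2 m).open_target.mem_nhds hu] with y hy
  exact hφ.tangentJet hy

theorem isPrincipalCurvature_iff (hφ : IsOrientedImmersion φ N)
    (hu : u ∈ (chartAt E2 m).target) (c : ℝ) :
    IsPrincipalCurvature φ N ((chartAt E2 m).symm u) c ↔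
      c = curvMax (partials (fun y => φ ((chartAt E2 m).symm y)) u)
          (partials (fun y => N ((chartAt E2 m).symm y)) u) ∨
      c = curvMin (partials (fun y => φ ((chartAt E2 m).symm y)) u)
          (partials (fun y => N ((chartAt E2 m).symm y)) u) := by
  have : IsManifold 𝓘(ℝ, E2) 1 M := IsManifold.of_le (n := 4) (by norm_num)
  have hb := mfderiv_chart_symm_bijective hu
  obtain ⟨-, hf⟩ := mfderiv_of_chart hu
    ((hφ.contDiffAt_position hu).differentiableAt (by norm_num))
  obtain ⟨-, hg⟩ := mfderiv_of_chart hu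
    ((hφ.contDiffAt_normal hu).differentiableAt (by norm_num))
  have hI : ∀ v w : E2, firstForm φ ((chartAt E2 m).symm u)
      (mfderiv 𝓘(ℝ, E2) 𝓘(ℝ, E2) (chartAt E2 m).symm u v)
      (mfderiv 𝓘(ℝ, E2) 𝓘(ℝ, E2) (chartAt E2 m).symm u w)
      = lor (fderiv ℝ (fun y => φ ((chartAt E2 m).symm y)) u v)
        (fderiv ℝ (fun y => φ ((chartAt E2 m).symm y)) u w) :=
    fun v w => congrArg₂ lor (hf v) (hf w)
  have hII : ∀ v w : E2, secondForm φ N ((chartAt E2 m).symm u)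
      (mfderiv 𝓘(ℝ, E2) 𝓘(ℝ, E2) (chartAt E2 m).symm u v)
      (mfderiv 𝓘(ℝ, E2) 𝓘(ℝ, E2) (chartAt E2 m).symm u w)
      = lor (fderiv ℝ (fun y => N ((chartAt E2 m).symm y)) u v)
        (fderiv ℝ (fun y => φ ((chartAt E2 m).symm y)) u w) :=
    fun v w => congrArg₂ lor (hg v) (hf w)
  rw [← (hφ.surfaceJet hu).exists_eigenvector_iff]
  constructor
  · rintro ⟨v, hv, h⟩
    obtain ⟨v, rfl⟩ := mfderiv_chart_symm_surjective hu v
    refine ⟨fun i => v i, fun h0 => hv ?_, fun j => ?_⟩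
    · have : v = 0 := by
        ext i
        exact congrFun h0 i
      exact (congrArg _ this).trans (map_zero _)
    · have h1 := h (mfderiv 𝓘(ℝ, E2) 𝓘(ℝ, E2) (chartAt E2 m).symm u (cvec j))
      rw [hI, hII, fderiv_eq_partials, fderiv_eq_partials _ u v, lor_add_left,
        lor_smul_left, lor_smul_left, lor_add_left, lor_smul_left, lor_smul_left] at h1
      exact h1
  · rintro ⟨c', hc, h⟩
    let v : E2 := c' 0 • cvec 0 + c' 1 • cvec 1
    have hv0 : v 0 = c' 0 := by simp [v, cvec]
    have hv1 : v 1 = c' 1 := by simp [v, cvec]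
    refine ⟨mfderiv 𝓘(ℝ, E2) 𝓘(ℝ, E2) (chartAt E2 m).symm u v, fun h0 => hc ?_, fun w => ?_⟩
    · have h1 : v = 0 := hb.1 (h0.trans (map_zero _).symm)
      funext i
      fin_cases i
      · exact hv0.symm.trans (by rw [h1]; rfl)
      · exact hv1.symm.trans (by rw [h1]; rfl)
    · obtain ⟨w', rfl⟩ := mfderiv_chart_symm_surjective hu w
      rw [hI, hII, fderiv_eq_partials, fderiv_eq_partials _ u v,
        fderiv_eq_partials _ u w', hv0, hv1, lor_comb_comb, lor_comb_comb]
      have e0 := h 0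
      have e1 := h 1
      linear_combination w' 0 * e0 + w' 1 * e1

theorem curv_eq (hφ : IsOrientedImmersion φ N) (hu : u ∈ (chartAt E2 m).target) :
    curv₁ φ N ((chartAt E2 m).symm u)
      = curvMax (partials (fun y => φ ((chartAt E2 m).symm y)) u)
          (partials (fun y => N ((chartAt E2 m).symm y)) u) ∧
    curv₂ φ N ((chartAt E2 m).symm u)
      = curvMin (partials (fun y => φ ((chartAt E2 m).symm y)) u)
          (partials (fun y => N ((chartAt E2 m).symm y)) u) := by
  have h : {c | IsPrincipalCurvature φ N ((chartAt E2 m).symm u) c}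
      = {curvMax (partials (fun y => φ ((chartAt E2 m).symm y)) u)
          (partials (fun y => N ((chartAt E2 m).symm y)) u),
        curvMin (partials (fun y => φ ((chartAt E2 m).symm y)) u)
          (partials (fun y => N ((chartAt E2 m).symm y)) u)} := by
    ext c
    exact hφ.isPrincipalCurvature_iff hu c
  have hle : curvMin (partials (fun y => φ ((chartAt E2 m).symm y)) u)
      (partials (fun y => N ((chartAt E2 m).symm y)) u)
      ≤ curvMax (partials (fun y => φ ((chartAt E2 m).symm y)) u)
      (partials (fun y => N ((chartAt E2 m).symm y)) u) := by
    simp only [curvMin, curvMax]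
    linarith [Real.sqrt_nonneg (curvDisc (partials (fun y => φ ((chartAt E2 m).symm y)) u)
      (partials (fun y => N ((chartAt E2 m).symm y)) u))]
  rw [curv₁, curv₂, h, csSup_pair, csInf_pair]
  exact ⟨sup_eq_left.2 hle, inf_eq_right.2 hle⟩

/-- The metric induced by the neutral metric, in a chart. -/
theorem inducedMetric_eq (hφ : IsOrientedImmersion φ N)
    (hu : u ∈ (chartAt E2 m).target) (v w : E2) :
    inducedMetric φ N ((chartAt E2 m).symm u)
      (mfderiv 𝓘(ℝ, E2) 𝓘(ℝ, E2) (chartAt E2 m).symm u v)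
      (mfderiv 𝓘(ℝ, E2) 𝓘(ℝ, E2) (chartAt E2 m).symm u w)
    = (vol (φ ((chartAt E2 m).symm u)) (N ((chartAt E2 m).symm u))
        (fderiv ℝ (fun y => φ ((chartAt E2 m).symm y)) u v)
        (fderiv ℝ (fun y => N ((chartAt E2 m).symm y)) u w)
      + vol (φ ((chartAt E2 m).symm u)) (N ((chartAt E2 m).symm u))
        (fderiv ℝ (fun y => φ ((chartAt E2 m).symm y)) u w)
        (fderiv ℝ (fun y => N ((chartAt E2 m).symm y)) u v)) / 2 := by
  have : IsManifold 𝓘(ℝ, E2) 1 M := IsManifold.of_le (n := 4) (by norm_num)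
  have hx := (hφ.contDiffAt_position hu).differentiableAt (by norm_num)
  have hn := (hφ.contDiffAt_normal hu).differentiableAt (by norm_num)
  set p := (chartAt E2 m).symm u with hp
  have haux := geod_aux (hφ.mem_hyp3 p) (hφ.normal_tangent_hyp3 p) (hφ.normal_unit p)
  obtain ⟨b1, b2⟩ := hasFDerivAt_ideal (hx.fun_sub hn) haux.1.ne'
  obtain ⟨e1, e2⟩ := hasFDerivAt_ideal (hx.fun_add hn) haux.2.ne'
  obtain ⟨-, hf⟩ := mfderiv_of_chart (F := normalMap φ N) hu (b1.prodMk e1)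
  have hF : ∀ z, fderiv ℝ (fun y => normalMap φ N ((chartAt E2 m).symm y)) u z
      = (idealDeriv (φ p - N p) (fderiv ℝ (fun y => φ ((chartAt E2 m).symm y)) u z
          - fderiv ℝ (fun y => N ((chartAt E2 m).symm y)) u z),
        idealDeriv (φ p + N p) (fderiv ℝ (fun y => φ ((chartAt E2 m).symm y)) u z
          + fderiv ℝ (fun y => N ((chartAt E2 m).symm y)) u z)) := by
    intro z
    have h1 := b2 z
    have h2 := e2 z
    rw [fderiv_fun_sub hx hn] at h1
    rw [fderiv_fun_add hx hn] at h2
    have h3 : fderiv ℝ (fun y => normalMap φ N ((chartAt E2 m).symm y)) u = _ :=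
      (b1.hasFDerivAt.prodMk e1.hasFDerivAt).fderiv
    rw [h3]
    exact Prod.ext h1 h2
  rw [inducedMetric, hf, hf, hF, hF]
  exact neutralMetric_normal (hφ.mem_hyp3 p) (hφ.normal_tangent_hyp3 p) (hφ.normal_unit p) _ _ _ _

/-- At an umbilic `dN = c dφ`, so `vol φ N (dφ v) (dN w)` is antisymmetric in `v`, `w`. The induced
metric, its symmetrization, is then zero, against non-degeneracy. -/
theorem curvDisc_ne_zero (hφ : IsOrientedImmersion φ N) (hnd : IsNondegenerate (inducedMetric φ N))
    (hu : u ∈ (chartAt E2 m).target) :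
    curvDisc (partials (fun y => φ ((chartAt E2 m).symm y)) u)
      (partials (fun y => N ((chartAt E2 m).symm y)) u) ≠ 0 := by
  have : IsManifold 𝓘(ℝ, E2) 1 M := IsManifold.of_le (n := 4) (by norm_num)
  have hb := mfderiv_chart_symm_bijective hu
  intro hd
  obtain ⟨c, hc⟩ := (hφ.surfaceJet hu).umbilic_of_curvDisc_eq_zero hd
  have hN : ∀ v : E2, fderiv ℝ (fun y => N ((chartAt E2 m).symm y)) u v
      = c • fderiv ℝ (fun y => φ ((chartAt E2 m).symm y)) u v := by
    intro v
    rw [fderiv_eq_partials, fderiv_eq_partials, hc, hc]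
    module
  have h0 := hnd _ (mfderiv 𝓘(ℝ, E2) 𝓘(ℝ, E2) (chartAt E2 m).symm u (cvec 0)) (fun w => by
    obtain ⟨w', rfl⟩ := mfderiv_chart_symm_surjective hu w
    rw [hφ.inducedMetric_eq hu, hN, hN]
    simp only [vol_eq, Pi.smul_apply, smul_eq_mul]
    ring)
  have h1 : (cvec 0 : E2) = 0 := hb.1 (h0.trans (map_zero _).symm)
  have h2 := congrArg (fun z : E2 => z 0) h1
  simp [cvec] at h2

/-- `gaussCurvature` at `m` is defined in the chart at `m`, so the plane statement applies there
directly and no invariance under coordinate change is needed. -/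
theorem gaussCurvature_eq_zero_iff (hφ : IsOrientedImmersion φ N)
    (hnd : IsNondegenerate (inducedMetric φ N)) (m : M) :
    gaussCurvature (inducedMetric φ N) m = 0 ↔
      pd 0 (fun y => curv₁ φ N ((chartAt E2 m).symm y)) (chartAt E2 m m)
          * pd 1 (fun y => curv₂ φ N ((chartAt E2 m).symm y)) (chartAt E2 m m)
        - pd 1 (fun y => curv₁ φ N ((chartAt E2 m).symm y)) (chartAt E2 m m)
          * pd 0 (fun y => curv₂ φ N ((chartAt E2 m).symm y)) (chartAt E2 m m) = 0 := by
  have hu := mem_chart_target E2 m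
  have ht := (chartAt E2 m).open_target.mem_nhds hu
  have h := planeGaussCurvature_normal_eq_zero_iff
    ((hφ.contDiffAt_position hu).of_le (by norm_num)) (hφ.contDiffAt_normal hu)
    (Filter.mem_of_superset ht fun y hy => hφ.surfaceJet hy) (hφ.curvDisc_ne_zero hnd hu)
    (g := metricCoeff (inducedMetric φ N) m)
    (Filter.mem_of_superset ht fun y hy i j => hφ.inducedMetric_eq hy (cvec i) (cvec j))
  rw [gaussCurvature, h]
  have e1 := fun i => pd_congr i (Filter.mem_of_superset ht fun y hy => (hφ.curv_eq hy).1)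
  have e2 := fun i => pd_congr i (Filter.mem_of_superset ht fun y hy => (hφ.curv_eq hy).2)
  rw [e1, e1, e2, e2]

theorem differentiableAt_curv (hφ : IsOrientedImmersion φ N) (hnd : IsNondegenerate (inducedMetric φ N))
    (hu : u ∈ (chartAt E2 m).target) :
    DifferentiableAt ℝ (fun y => curv₁ φ N ((chartAt E2 m).symm y)) u ∧
    DifferentiableAt ℝ (fun y => curv₂ φ N ((chartAt E2 m).symm y)) u := by
  have ht := (chartAt E2 m).open_target.mem_nhds hu
  obtain ⟨-, h1, h2⟩ := contDiffAt_curv ((hφ.contDiffAt_position hu).of_le (by norm_num))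
    (hφ.contDiffAt_normal hu) (hφ.surfaceJet hu) (hφ.curvDisc_ne_zero hnd hu)
  exact ⟨(h1.differentiableAt (by norm_num)).congr_of_eventuallyEq
      (Filter.mem_of_superset ht fun y hy => (hφ.curv_eq hy).1),
    (h2.differentiableAt (by norm_num)).congr_of_eventuallyEq
      (Filter.mem_of_superset ht fun y hy => (hφ.curv_eq hy).2)⟩

end IsOrientedImmersion

/-- The wedge product of the differentials of two functions, in a chart. -/
theorem wedge_mfderiv_eq_zero_iff [IsManifold 𝓘(ℝ, E2) 1 M] {a b : M → ℝ} {m : M} {u : E2}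
    (hu : u ∈ (chartAt E2 m).target)
    (ha : DifferentiableAt ℝ (fun y => a ((chartAt E2 m).symm y)) u)
    (hb : DifferentiableAt ℝ (fun y => b ((chartAt E2 m).symm y)) u) :
    (∀ v w : TangentSpace 𝓘(ℝ, E2) ((chartAt E2 m).symm u),
      (show ℝ from mfderiv 𝓘(ℝ, E2) 𝓘(ℝ, ℝ) a ((chartAt E2 m).symm u) v) *
          (show ℝ from mfderiv 𝓘(ℝ, E2) 𝓘(ℝ, ℝ) b ((chartAt E2 m).symm u) w)
        - (show ℝ from mfderiv 𝓘(ℝ, E2) 𝓘(ℝ, ℝ) a ((chartAt E2 m).symm u) w) *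
          (show ℝ from mfderiv 𝓘(ℝ, E2) 𝓘(ℝ, ℝ) b ((chartAt E2 m).symm u) v) = 0) ↔
      pd 0 (fun y => a ((chartAt E2 m).symm y)) u * pd 1 (fun y => b ((chartAt E2 m).symm y)) u
        - pd 1 (fun y => a ((chartAt E2 m).symm y)) u
          * pd 0 (fun y => b ((chartAt E2 m).symm y)) u = 0 := by
  obtain ⟨-, hf⟩ := mfderiv_of_chart hu ha
  obtain ⟨-, hg⟩ := mfderiv_of_chart hu hb
  constructor
  · intro h
    have h1 := h (mfderiv 𝓘(ℝ, E2) 𝓘(ℝ, E2) (chartAt E2 m).symm u (cvec 0))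
      (mfderiv 𝓘(ℝ, E2) 𝓘(ℝ, E2) (chartAt E2 m).symm u (cvec 1))
    rw [hf, hf, hg, hg] at h1
    exact h1
  · intro h v w
    obtain ⟨v', rfl⟩ := mfderiv_chart_symm_surjective hu v
    obtain ⟨w', rfl⟩ := mfderiv_chart_symm_surjective hu w
    rw [hf, hf, hg, hg, fderiv_eq_pd, fderiv_eq_pd, fderiv_eq_pd, fderiv_eq_pd]
    change (v' 0 * _ + v' 1 * _) * (w' 0 * _ + w' 1 * _)
      - (w' 0 * _ + w' 1 * _) * (v' 0 * _ + v' 1 * _) = (0 : ℝ)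
    linear_combination (v' 0 * w' 1 - v' 1 * w' 0) * h

end Chart

end HypSurface

end

/-- Main theorem. `φ : M → H³` is a `C⁴` immersed oriented surface with unit normal field `N`.
If the metric that the neutral Kaehler metric of `L(H³)` induces on the surface of oriented normal
geodesics is non-degenerate, then the surface is Weingarten if and only if the Gauss curvature of
the induced metric is zero. -/
theorem mainTheorem1 {M : Type*} [TopologicalSpace M] [ChartedSpace HypSurface.E2 M]
    [IsManifold 𝓘(ℝ, HypSurface.E2) 4 M]
    (φ N : M → HypSurface.Mink) (hφ : HypSurface.IsOrientedImmersion φ N)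
    (hnondeg : HypSurface.IsNondegenerate (HypSurface.inducedMetric φ N)) :
    HypSurface.IsWeingarten φ N ↔
      ∀ m : M, HypSurface.gaussCurvature (HypSurface.inducedMetric φ N) m = 0 := by
  have : IsManifold 𝓘(ℝ, HypSurface.E2) 1 M := IsManifold.of_le (n := 4) (by norm_num)
  have hd := fun m : M => hφ.differentiableAt_curv hnondeg (mem_chart_target HypSurface.E2 m)
  have hm : ∀ m : M, (chartAt HypSurface.E2 m).symm (chartAt HypSurface.E2 m m) = m := fun m =>
    (chartAt HypSurface.E2 m).left_inv (mem_chart_source HypSurface.E2 m)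
  have hw := fun m : M => HypSurface.wedge_mfderiv_eq_zero_iff
    (mem_chart_target HypSurface.E2 m) (hd m).1 (hd m).2
  -- Flatness at `m` is now the vanishing of the wedge product at `m`; what remains is the
  -- differentiability of the curvatures, which non-degeneracy supplies.
  simp only [hφ.gaussCurvature_eq_zero_iff hnondeg, ← hw]
  have h1 : MDifferentiable 𝓘(ℝ, HypSurface.E2) 𝓘(ℝ, ℝ) (HypSurface.curv₁ φ N) := fun m => by
    have := (HypSurface.mfderiv_of_chart (mem_chart_target HypSurface.E2 m) (hd m).1).1
    rwa [hm] at this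
  have h2 : MDifferentiable 𝓘(ℝ, HypSurface.E2) 𝓘(ℝ, ℝ) (HypSurface.curv₂ φ N) := fun m => by
    have := (HypSurface.mfderiv_of_chart (mem_chart_target HypSurface.E2 m) (hd m).2).1
    rwa [hm] at this
  constructor
  · rintro ⟨-, -, h⟩ m
    exact h _
  · intro h
    refine ⟨h1, h2, fun m => ?_⟩
    have h3 := h m
    rwa [hm] at h3
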